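/- Let $H$ be a complex Hilbert space (for instance $\mathbb C^n$ or $\ell_2(\mathbb N)$), let $\Omega\subseteq\mathbb R$ be open, let $\widetilde\Omega\subseteq\Omega$ be compact, let $f_1,\dots,f_\kappa:\Omega\to\mathbb R$ be real analytic, let $A_1,\dots,A_\kappa$ be bounded linear operators on $H$, and put $A(x)=f_1(x)A_1+\dots+f_\kappa(x)A_\kappa$. For a bounded linear operator $S$ let $\sigma_{\min}(S)=\inf\{\|Sw\| : \|w\|=1\}$ be its smallest singular value. A vector $v\neq 0$ is a right singular vector of $T$ for the singular value $s\ge 0$ if $T^*Tv=s^2v$. The singular value $s$ is simple if the eigenspace of $T^*T$ for $s^2$ is one-dimensional and $s^2$ is an isolated point of the spectrum of $T^*T$ (the second condition is automatic if $\dim H<\infty$). The distance to instability of a bounded linear operator $T$ on $H$ is $$\mathcal D(T)=\inf\{\|\Delta\| : T+\Delta-zI \text{ is not invertible for some } z\in\mathbb C \text{ with } \operatorname{Re} z\ge 0\},$$ and for a subspace $\mathcal V\subseteq H$ the reduced distance is $$\widetilde{\mathcal D}^{\mathcal V}(T)=\inf_{\omega\in\mathbb R}\sigma_{\min}\big((T-\omega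 \mathrm i I)|_{\mathcal V}\big).$$ Let sequences $x^{(\ell)}\in\widetilde\Omega$, $\omega^{(\ell)}\in\mathbb R$, $v_\ell\in H$ and subspaces $\mathcal V_\ell\subseteq H$ ($\ell\ge 1$) be generated by the following algorithm: $x^{(1)}\in\widetilde\Omega$ is arbitrary; for every $\ell\ge 1$, $\omega^{(\ell)}$ is a global minimizer of $\omega\mapsto\sigma_{\min}(A(x^{(\ell)})-\omega\mathrm i I)$ over $\mathbb R$ and $v_\ell$ is a right singular vector of $A(x^{(\ell)})-\omega^{(\ell)}\mathrm i I$ for its smallest singular value; $\mathcal V_1=\operatorname{span}\{v_1\}$ and $\mathcal V_{\ell+1}=\mathcal V_\ell+\operatorname{span}\{v_{\ell+1}\}$; and $x^{(\ell+1)}$ is a global maximizer of $x\mapsto\widetilde{\mathcal D}^{\mathcal V_\ell}(A(x))$ over $\widetilde\Omega$. Suppose that for every $x\in\widetilde\Omega$ all eigenvalues of $A(x)$ lie in the closed left half-plane, and that $x^{(\ell)}$ converges to a point $x_*$ in the interior of $\widetilde\Omega$ such that (i) there is exactly one $\omega_*\in\mathbb R$ with $\mathcal D(A(x_*))=\sigma_{\min}(A(x_*)-\omega_*\mathrm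 i I)$, this singular value is positive and simple, and $\frac{\partial^2}{\partial\omega^2}\sigma_{\min}(A(x_*)-\omega\mathrm i I)\big|_{\omega=\omega_*}>0$; (ii) the second derivative of $x\mapsto\mathcal D(A(x))$ at $x_*$ is nonzero. Then there is a constant $\mu>0$ such that, for all $\ell\ge 2$ with $x^{(\ell)}\ne x_*$, $$\frac{|x^{(\ell+1)}-x_*|}{|x^{(\ell)}-x_*|\,\max\{|x^{(\ell)}-x_*|,\,|x^{(\ell-1)}-x_*|\}}\le\mu .$$ -/

import Mathlib

namespace DistInstab

noncomputable section

open scoped ComplexInnerProductSpace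
open ContinuousLinearMap

/-- The smallest singular value of a bounded operator `S : E → F`,
`σ_min(S) = inf { ‖S w‖ : ‖w‖ = 1 }` (a minimum when `E` is finite dimensional). -/
def sigmaMin {E F : Type*} [NormedAddCommGroup E] [NormedSpace ℂ E]
    [NormedAddCommGroup F] [NormedSpace ℂ F] (S : E →L[ℂ] F) : ℝ :=
  sInf {r : ℝ | ∃ w : E, ‖w‖ = 1 ∧ ‖S w‖ = r}

section Hilbert

variable {H : Type*} [NormedAddCommGroup H] [InnerProductSpace ℂ H]

/-- `A(x) = f₁(x) A₁ + ⋯ + f_κ(x) A_κ`. -/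
def opFamily {κ : ℕ} (f : Fin κ → ℝ → ℝ) (A : Fin κ → H →L[ℂ] H) (x : ℝ) : H →L[ℂ] H :=
  ∑ j, ((f j x : ℝ) : ℂ) • A j

/-- `T - ω i I` for real `ω`. -/
def imShift (T : H →L[ℂ] H) (ω : ℝ) : H →L[ℂ] H :=
  T - ((ω : ℂ) * Complex.I) • ContinuousLinearMap.id ℂ H

/-- The distance to instability
`𝒟(T) = inf { ‖Δ‖ : T + Δ - z I is singular for some z with Re z ≥ 0 }`,
the norm being the operator 2-norm. -/
def distInstab (T : H →L[ℂ] H) : ℝ :=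
  sInf {r : ℝ | ∃ Δ : H →L[ℂ] H, ‖Δ‖ = r ∧ ∃ z : ℂ, 0 ≤ z.re ∧ z ∈ spectrum ℂ (T + Δ)}

/-- The reduced distance `min_{ω ∈ ℝ} σ_min(T V - ω i V)`, where the columns of `V` are an
orthonormal basis of `𝒱`. As `V` is an isometry onto `𝒱`, the singular values of
`T V - ω i V` are those of the restriction of `T - ω i I` to `𝒱`. -/
def redDist (𝒱 : Submodule ℂ H) (T : H →L[ℂ] H) : ℝ :=
  ⨅ ω : ℝ, sigmaMin ((imShift T ω).comp 𝒱.subtypeL)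

variable [CompleteSpace H]

/-- `v` is a right singular vector of `T` for the singular value `s`. -/
def IsRightSingularVector (T : H →L[ℂ] H) (s : ℝ) (v : H) : Prop :=
  v ≠ 0 ∧ (adjoint T) (T v) = ((s : ℂ) ^ 2) • v

/-- The singular value `s` of `T` is simple: `s²` is an eigenvalue of `T* T` with a
one-dimensional eigenspace, and an isolated point of the spectrum of `T* T`
(the latter is automatic in finite dimension). -/
def IsSimpleSingularValue (T : H →L[ℂ] H) (s : ℝ) : Prop :=
  Module.finrank ℂ
      (Module.End.eigenspace (((adjoint T).comp T : H →L[ℂ] H) : H →ₗ[ℂ] H) ((s : ℂ) ^ 2)) = 1 ∧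
    ∃ ε > 0, ∀ t ∈ spectrum ℂ ((adjoint T).comp T), t ≠ (s : ℂ) ^ 2 → ε ≤ ‖t - (s : ℂ) ^ 2‖

/-- `x`, `ω`, `v`, `𝒱` (indexed from `1`; the values at `0` are irrelevant) form a run of the
subspace framework with inner minimization over the imaginary axis, for the operator function
`A` of one real parameter and the feasible region `K`. -/
structure IsSubspaceRun (A : ℝ → H →L[ℂ] H) (K : Set ℝ)
    (x ω : ℕ → ℝ) (v : ℕ → H) (𝒱 : ℕ → Submodule ℂ H) : Prop where
  /-- the starting point is an arbitrary point of the feasible region -/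
  start_mem : x 1 ∈ K
  /-- `ω⁽ˡ⁾` is a global minimizer of `σ_min(A(x⁽ˡ⁾) - ω i I)` over the real line -/
  isMinOn_omega : ∀ l ≥ 1, IsMinOn (fun w : ℝ => sigmaMin (imShift (A (x l)) w)) Set.univ (ω l)
  /-- `v_l` is a right singular vector for `σ_min(A(x⁽ˡ⁾) - ω⁽ˡ⁾ i I)` -/
  singular : ∀ l ≥ 1, IsRightSingularVector (imShift (A (x l)) (ω l))
    (sigmaMin (imShift (A (x l)) (ω l))) (v l)
  /-- the first subspace is spanned by the first singular vector -/
  span_one : 𝒱 1 = Submodule.span ℂ {v 1}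
  /-- the subspace is expanded by the new singular vector -/
  span_succ : ∀ l ≥ 1, 𝒱 (l + 1) = 𝒱 l ⊔ Submodule.span ℂ {v (l + 1)}
  /-- the next iterate is feasible -/
  next_mem : ∀ l ≥ 1, x (l + 1) ∈ K
  /-- the next iterate is a global maximizer of the reduced distance over the feasible region -/
  isMaxOn_next : ∀ l ≥ 1, IsMaxOn (fun y : ℝ => redDist (𝒱 l) (A y)) K (x (l + 1))

end Hilbert

end

end DistInstab

/-! Write `g y = 𝒟(A y)`, and let `u y` be the singular vector at the minimizing frequency `ψ y`,
normalized by `⟪e, u y⟫ = 1`. Near the limit `a`, both `g` and `u` are `C²`. For every subspace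
containing some `w` with `⟪e, w⟫ = 1`, the reduced distance at `y` is at most `g y + C ‖w - u y‖²`:
a singular vector is a critical point of the Rayleigh quotient, so there is no first-order error
(`redDist_le_add`). For every nonzero subspace it is at least `g y`.

The subspace `𝒱 (l+1)` contains `u (x l)` and `u (x (l+1))`, hence their affine interpolant, which
misses `u y` by `O(|y - x l| |y - x (l+1)|)` (`exists_interpolation_bound`). At `y = x (l+2)`,
maximality gives `g a ≤ g y + O(|y - x l|² |y - x (l+1)|²)`. Passing to the limit with single-vector
bounds shows that `a` maximizes `g` on `K`, so the nonzero second derivative yields `g y ≤ g a - c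
(y - a)²`. Combining and taking square roots gives `|y - a| ≤ Q |y - x l| |y - x (l+1)|`; since the
iterates converge, the terms in `|y - a|` on the right are absorbed.

Smoothness (`exists_local_structure`) rests on three facts: a simple isolated singular pair solves a
smooth bordered equation, a nondegenerate minimizer over the frequency persists, and the maximum
principle for the resolvent identifies `𝒟` with the minimum over the imaginary axis. -/

namespace DistInstab

open ContinuousLinearMap Filter Topology
open scoped InnerProductSpace

/-! ### Smallest singular values: homogeneity and Lipschitz dependence -/

section SigmaMin

variable {E F : Type*} [NormedAddCommGroup E] [NormedSpace ℂ E]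
  [NormedAddCommGroup F] [NormedSpace ℂ F]

lemma sigmaMin_nonneg (S : E →L[ℂ] F) : 0 ≤ sigmaMin S :=
  Real.sInf_nonneg (by rintro r ⟨w, -, rfl⟩; exact norm_nonneg _)

lemma sigmaMin_mul_norm_le (S : E →L[ℂ] F) (w : E) : sigmaMin S * ‖w‖ ≤ ‖S w‖ := by
  rcases eq_or_ne w 0 with rfl | hw
  · simp
  have hw' : 0 < ‖w‖ := norm_pos_iff.2 hw
  rw [← le_div_iff₀ hw']
  refine csInf_le ⟨0, by rintro r ⟨w, -, rfl⟩; exact norm_nonneg _⟩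
    ⟨((‖w‖⁻¹ : ℝ) : ℂ) • w, ?_, ?_⟩
  · rw [norm_smul, Complex.norm_real, Real.norm_of_nonneg (by positivity), inv_mul_cancel₀ hw'.ne']
  · rw [map_smul, norm_smul, Complex.norm_real, Real.norm_of_nonneg (by positivity),
      inv_mul_eq_div]

lemma le_sigmaMin [Nontrivial E] {S : E →L[ℂ] F} {c : ℝ} (h : ∀ w, c * ‖w‖ ≤ ‖S w‖) :
    c ≤ sigmaMin S := by
  obtain ⟨w, hw⟩ := NormedSpace.exists_lt_norm ℂ E 0
  refine le_csInf ⟨_, ((‖w‖⁻¹ : ℝ) : ℂ) • w, ?_, rfl⟩ ?_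
  · rw [norm_smul, Complex.norm_real, Real.norm_of_nonneg (by positivity), inv_mul_cancel₀ hw.ne']
  · rintro r ⟨w, hw, rfl⟩
    simpa [hw] using h w

lemma sigmaMin_sub_le [Nontrivial E] (S T : E →L[ℂ] F) :
    sigmaMin S - ‖S - T‖ ≤ sigmaMin T := by
  refine le_sigmaMin fun w => ?_
  have h1 := sigmaMin_mul_norm_le S w
  have h2 := (S - T).le_opNorm w
  have h3 : ‖S w‖ ≤ ‖(S - T) w‖ + ‖T w‖ := by
    simpa using norm_add_le ((S - T) w) (T w)
  linarith [sub_mul (sigmaMin S) ‖S - T‖ ‖w‖]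

lemma abs_sigmaMin_sub_le [Nontrivial E] (S T : E →L[ℂ] F) :
    |sigmaMin S - sigmaMin T| ≤ ‖S - T‖ := by
  rw [abs_le]
  have h1 := sigmaMin_sub_le S T
  have h2 := sigmaMin_sub_le T S
  rw [norm_sub_rev] at h2
  constructor <;> linarith

end SigmaMin

/-! ### Spectral gap of a quadratic form -/

section Spectral

variable {H : Type*} [NormedAddCommGroup H] [InnerProductSpace ℂ H] [CompleteSpace H]

/-- If the lower bound `s` of a self-adjoint operator is a simple eigenvalue which is isolated in
the spectrum, then the quadratic form grows quadratically away from the eigenvector. -/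
lemma quadraticForm_gap {M : H →L[ℂ] H} (hM : IsSelfAdjoint M) {s ε : ℝ} (hε : 0 < ε)
    (hs : ∀ w, s * ‖w‖ ^ 2 ≤ (⟪M w, w⟫_ℂ).re)
    (hiso : ∀ t ∈ spectrum ℂ M, t ≠ (s : ℂ) → ε ≤ ‖t - s‖) {e : H} (he : ‖e‖ = 1)
    (heig : ∀ w, M w = (s : ℂ) • w → w = ⟪e, w⟫_ℂ • e) (w : H) :
    s * ‖w‖ ^ 2 + ε * (‖w‖ ^ 2 - ‖⟪e, w⟫_ℂ‖ ^ 2) ≤ (⟪M w, w⟫_ℂ).re := by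
  have hMs : 0 ≤ M - algebraMap ℝ (H →L[ℂ] H) s := by
    rw [ContinuousLinearMap.nonneg_iff_isPositive]
    refine ⟨(hM.sub ((IsSelfAdjoint.all s).algebraMap _)).isSymmetric, fun w => ?_⟩
    have h1 : (⟪((s : ℂ)) • w, w⟫_ℂ).re = s * ‖w‖ ^ 2 := by
      rw [inner_smul_left, Complex.conj_ofReal, Complex.re_ofReal_mul]
      congr 1
      exact inner_self_eq_norm_sq (𝕜 := ℂ) w
    have h2 : (algebraMap ℝ (H →L[ℂ] H) s) w = (s : ℂ) • w := by
      simp [Algebra.algebraMap_eq_smul_one]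
    simp only [ContinuousLinearMap.reApplyInnerSelf_apply, sub_apply, h2, inner_sub_left]
    have := hs w
    simp only [map_sub, RCLike.re_to_complex, h1]
    linarith
  have hspec : ∀ t ∈ spectrum ℝ M, s ≤ t := by
    intro t ht
    have h1 : t - s ∈ spectrum ℝ (M - algebraMap ℝ (H →L[ℂ] H) s) := by
      rw [← spectrum.sub_singleton_eq]
      exact Set.sub_mem_sub ht rfl
    have := spectrum_nonneg_of_nonneg hMs h1
    linarith
  have hiso' : ∀ t ∈ spectrum ℝ M, t ≠ s → s + ε ≤ t := by
    intro t ht hts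
    have h1 : (t : ℂ) ∈ spectrum ℂ M := spectrum.algebraMap_mem ℂ ht
    have h2 := hiso t h1 (by exact_mod_cast hts)
    rw [← Complex.ofReal_sub, Complex.norm_real, Real.norm_of_nonneg (by linarith [hspec t ht])]
      at h2
    linarith
  -- Since `s` is isolated, a continuous tent function agrees on the spectrum with the indicator of
  -- `{s}`. Thus `χ(M)` is the spectral projection onto the eigenspace, within the continuous
  -- functional calculus.
  obtain ⟨χ, hχc, hχs, hχ0⟩ : ∃ χ : ℝ → ℝ, Continuous χ ∧ χ s = 1 ∧
      ∀ t ∈ spectrum ℝ M, t ≠ s → χ t = 0 := by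
    refine ⟨fun t => max 0 (1 - |t - s| / ε), by fun_prop, by simp, fun t ht hts => ?_⟩
    have h1 := hiso' t ht hts
    have : 1 ≤ |t - s| / ε := by
      rw [le_div_iff₀ hε, abs_of_nonneg (by linarith)]; linarith
    simp [this]
  have hχo := hχc.continuousOn (s := spectrum ℝ M)
  have hido := continuousOn_id' (spectrum ℝ M)
  have hso : ContinuousOn (fun _ : ℝ => s) (spectrum ℝ M) := continuousOn_const
  have h1o : ContinuousOn (fun _ : ℝ => (1 : ℝ)) (spectrum ℝ M) := continuousOn_const
  set P : H →L[ℂ] H := cfc χ M with hP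
  have hPn : ‖P‖ ≤ 1 := by
    refine norm_cfc_le zero_le_one fun t ht => ?_
    by_cases hts : t = s
    · simp [hts, hχs]
    · simp [hχ0 t ht hts]
  have hPsa : IsSelfAdjoint P := cfc_predicate χ M
  have hMid : cfc (fun t : ℝ => t) M = M := cfc_id' ℝ M
  have hMP : M * P = s • P := by
    conv_lhs => rw [← hMid, hP, ← cfc_mul (fun t : ℝ => t) χ M hido hχo]
    rw [hP, ← cfc_smul s χ M hχo]
    refine cfc_congr fun t ht => ?_
    by_cases hts : t = s
    · simp [hts]
    · simp [hχ0 t ht hts]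
  -- The operator inequality is the scalar one `t - s ≥ ε (1 - χ t)` on the spectrum.
  have hpos : 0 ≤ M - algebraMap ℝ (H →L[ℂ] H) s - ε • (1 - P) := by
    have h1 : M - algebraMap ℝ (H →L[ℂ] H) s - ε • (1 - P)
        = cfc (fun t : ℝ => t - s - ε • (1 - χ t)) M := by
      rw [cfc_sub (fun t : ℝ => t - s) (fun t => ε • (1 - χ t)) M (hido.sub hso)
          ((h1o.sub hχo).const_smul ε),
        cfc_sub (fun t : ℝ => t) (fun _ => s) M hido hso, hMid, cfc_const s M hM, 
        cfc_smul ε (fun t => 1 - χ t) M (h1o.sub hχo),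
        cfc_sub (fun _ => 1) χ M h1o hχo, cfc_const_one ℝ M hM]
    rw [h1]
    refine cfc_nonneg fun t ht => ?_
    by_cases hts : t = s
    · simp [hts, hχs]
    · have := hiso' t ht hts
      simp only [hχ0 t ht hts, smul_eq_mul]
      linarith
  have hPw : ∀ w, P w = ⟪e, P w⟫_ℂ • e := fun w => by
    refine heig _ ?_
    have := congrArg (fun L : H →L[ℂ] H => L w) hMP
    simpa using this
  have hcoef : ∀ w, ⟪e, P w⟫_ℂ = ⟪P e, w⟫_ℂ := fun w => (hPsa.isSymmetric e w).symm
  have hnorm : ‖⟪P w, w⟫_ℂ‖ ≤ ‖⟪e, w⟫_ℂ‖ ^ 2 := by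
    have h1 : ‖⟪e, P e⟫_ℂ‖ ≤ 1 := by
      calc ‖⟪e, P e⟫_ℂ‖ ≤ ‖e‖ * ‖P e‖ := norm_inner_le_norm _ _
        _ ≤ 1 := by
          rw [he, one_mul]
          exact (P.le_opNorm e).trans (by simpa [he] using hPn)
    rw [hPw w, inner_smul_left, norm_mul, RCLike.norm_conj, hcoef, hPw e, inner_smul_left,
      norm_mul, RCLike.norm_conj]
    nlinarith [sq_nonneg ‖⟪e, w⟫_ℂ‖]
  have h2 := (ContinuousLinearMap.nonneg_iff_isPositive _).1 hpos |>.re_inner_nonneg_left w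
  have h3 : (algebraMap ℝ (H →L[ℂ] H) s) w = (s : ℂ) • w := by
    simp [Algebra.algebraMap_eq_smul_one]
  have h4 : (ε • (1 - P)) w = (ε : ℂ) • (w - P w) := by
    simp
  simp only [sub_apply, h3, h4, inner_sub_left, inner_smul_left, Complex.conj_ofReal,
    map_sub, RCLike.re_to_complex, Complex.re_ofReal_mul] at h2
  have h5 : (⟪w, w⟫_ℂ).re = ‖w‖ ^ 2 := inner_self_eq_norm_sq (𝕜 := ℂ) w
  have h6 : (⟪P w, w⟫_ℂ).re ≤ ‖⟪e, w⟫_ℂ‖ ^ 2 := (Complex.re_le_norm _).trans hnorm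
  simp only [Complex.sub_re, h5] at h2
  nlinarith

end Spectral

/-- The implicit function theorem for a scalar equation in a scalar unknown. -/
lemma exists_implicit_scalar {E : Type*} [NormedAddCommGroup E] [NormedSpace ℝ E] [CompleteSpace E]
    {n : WithTop ℕ∞} (hn : n ≠ 0) {φ : E × ℝ → ℝ} {p₀ : E} {s₀ d : ℝ}
    (hφ : ContDiffAt ℝ n φ (p₀, s₀)) (h0 : φ (p₀, s₀) = 0)
    (hd : HasDerivAt (fun s => φ (p₀, s)) d s₀) (hd0 : d ≠ 0) :
    ∃ ψ : E → ℝ, ContDiffAt ℝ n ψ p₀ ∧ ψ p₀ = s₀ ∧ ∀ᶠ p in 𝓝 p₀, φ (p, ψ p) = 0 := by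
  have hdiff := (hφ.differentiableAt hn).hasFDerivAt
  have hcomp : (fderiv ℝ φ (p₀, s₀) ∘L .inr ℝ E ℝ) = ContinuousLinearMap.toSpanSingleton ℝ d := by
    have h1 : HasFDerivAt (fun s : ℝ => (p₀, s)) (.inr ℝ E ℝ) s₀ := by
      exact (hasFDerivAt_const p₀ s₀).prodMk (hasFDerivAt_id s₀)
    exact (HasFDerivAt.comp s₀ hdiff h1).unique hd.hasFDerivAt
  have hinv : (fderiv ℝ φ (p₀, s₀) ∘L .inr ℝ E ℝ).IsInvertible := by
    refine ⟨ContinuousLinearEquiv.unitsEquivAut ℝ (Units.mk0 d hd0), ?_⟩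
    rw [hcomp]
    ext
    simp
  refine ⟨hφ.implicitFunction hn hinv, hφ.contDiffAt_implicitFunction hn hinv,
    hφ.implicitFunction_apply_self hn hinv, ?_⟩
  simpa [h0] using hφ.eventually_apply_implicitFunction hn hinv

/-! ### The bordered Gram operator -/

section BorderedGram

variable {H : Type*} [NormedAddCommGroup H] [InnerProductSpace ℂ H] [CompleteSpace H]

lemma re_inner_adjoint_comp_self (T : H →L[ℂ] H) (w : H) :
    (⟪adjoint T (T w), w⟫_ℂ).re = ‖T w‖ ^ 2 := by
  rw [adjoint_inner_left]
  exact inner_self_eq_norm_sq (𝕜 := ℂ) _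

lemma sigmaMin_sq_mul_le {E F : Type*} [NormedAddCommGroup E] [NormedSpace ℂ E]
    [NormedAddCommGroup F] [NormedSpace ℂ F] (T : E →L[ℂ] F) (w : E) :
    sigmaMin T ^ 2 * ‖w‖ ^ 2 ≤ ‖T w‖ ^ 2 := by
  rw [← mul_pow]
  exact pow_le_pow_left₀ (mul_nonneg (sigmaMin_nonneg _) (norm_nonneg _))
    (sigmaMin_mul_norm_le T w) 2

/-- The shifted Gram operator `T* T - s` bordered by the rank one projection on `e`. -/
noncomputable def borderedGram (e : H) (T : H →L[ℂ] H) (s : ℝ) : H →L[ℂ] H :=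
  star T * T - s • (1 : H →L[ℂ] H) + InnerProductSpace.rankOne ℂ e e

lemma borderedGram_apply (e : H) (T : H →L[ℂ] H) (s : ℝ) (w : H) :
    borderedGram e T s w = adjoint T (T w) - (s : ℂ) • w + ⟪e, w⟫_ℂ • e := by
  simp [borderedGram, ContinuousLinearMap.star_eq_adjoint]

lemma borderedGram_isSymmetric (e : H) (T : H →L[ℂ] H) (s : ℝ) (x y : H) :
    ⟪borderedGram e T s x, y⟫_ℂ = ⟪x, borderedGram e T s y⟫_ℂ := by
  simp only [borderedGram_apply, inner_add_left, inner_add_right, inner_sub_left, inner_sub_right,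
    inner_smul_left, inner_smul_right, adjoint_inner_left, adjoint_inner_right,
    Complex.conj_ofReal, inner_conj_symm]
  ring

lemma re_inner_borderedGram (e : H) (T : H →L[ℂ] H) (s : ℝ) (w : H) :
    (⟪borderedGram e T s w, w⟫_ℂ).re = ‖T w‖ ^ 2 - s * ‖w‖ ^ 2 + ‖⟪e, w⟫_ℂ‖ ^ 2 := by
  have h5 : (⟪w, w⟫_ℂ).re = ‖w‖ ^ 2 := inner_self_eq_norm_sq (𝕜 := ℂ) w
  have h6 : (starRingEnd ℂ ⟪e, w⟫_ℂ) * ⟪e, w⟫_ℂ = ((‖⟪e, w⟫_ℂ‖ ^ 2 : ℝ) : ℂ) := by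
    rw [Complex.conj_mul']; simp
  rw [borderedGram_apply, inner_add_left, inner_sub_left, inner_smul_left, inner_smul_left,
    Complex.conj_ofReal, h6, Complex.add_re, Complex.sub_re, Complex.re_ofReal_mul, h5,
    re_inner_adjoint_comp_self, Complex.ofReal_re]

/-- If the bordered Gram operator is positive definite and its solution `u` for the right-hand side
`e` has `⟪e, u⟫ = 1`, then `√s` is the smallest singular value of `T`, with right singular
vector `u`, unique up to scaling. -/
lemma singular_pair_of_borderedGram {e u : H} {T : H →L[ℂ] H} {s c : ℝ}
    (hc : 0 < c) (hpd : ∀ w, c * ‖w‖ ^ 2 ≤ (⟪borderedGram e T s w, w⟫_ℂ).re)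
    (hu : borderedGram e T s u = e) (hre : (⟪e, u⟫_ℂ).re = 1) :
    ⟪e, u⟫_ℂ = 1 ∧ sigmaMin T ^ 2 = s ∧ adjoint T (T u) = (s : ℂ) • u ∧
      ∀ w, adjoint T (T w) = (s : ℂ) • w → w = ⟪e, w⟫_ℂ • u := by
  -- Symmetry and `G u = e` make `⟪e, u⟫ = ⟪G u, u⟫` real, so the real equation `hre` suffices.
  have h1 : ⟪e, u⟫_ℂ = 1 := by
    have him : (starRingEnd ℂ) ⟪e, u⟫_ℂ = ⟪e, u⟫_ℂ := by
      rw [inner_conj_symm]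
      nth_rewrite 1 [← hu]
      rw [← borderedGram_isSymmetric, hu]
    rw [Complex.conj_eq_iff_re] at him
    rw [← him, hre, Complex.ofReal_one]
  have hMu : adjoint T (T u) = (s : ℂ) • u := by
    have := borderedGram_apply e T s u
    rw [hu, h1, one_smul] at this
    exact sub_eq_zero.1 (by simpa using this.symm)
  have hu0 : u ≠ 0 := by rintro rfl; simp at h1
  have : Nontrivial H := ⟨u, 0, hu0⟩
  have hTu : ‖T u‖ ^ 2 = s * ‖u‖ ^ 2 := by
    rw [← re_inner_adjoint_comp_self, hMu, inner_smul_left, Complex.conj_ofReal,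
      Complex.re_ofReal_mul]
    congr 1
    exact inner_self_eq_norm_sq (𝕜 := ℂ) _
  have hun : 0 < ‖u‖ ^ 2 := by have := norm_pos_iff.2 hu0; positivity
  have hs : 0 ≤ s := by
    by_contra! hs
    nlinarith [sq_nonneg ‖T u‖]
  -- Split `w` into a multiple of `u` and a part orthogonal to `e`. On the latter the border
  -- vanishes and positivity of `G` applies; the cross terms match because `u` is an eigenvector.
  have hlow : ∀ w, s * ‖w‖ ^ 2 ≤ ‖T w‖ ^ 2 := by
    intro w
    set w' := w - ⟪e, w⟫_ℂ • u with hw'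
    have hew' : ⟪e, w'⟫_ℂ = 0 := by
      rw [hw', inner_sub_right, inner_smul_right, h1, mul_one, sub_self]
    have h2 := hpd w'
    rw [re_inner_borderedGram, hew'] at h2
    have hw : w = w' + ⟪e, w⟫_ℂ • u := by simp [hw']
    set a := ⟪e, w⟫_ℂ
    have hcross : ⟪T w', T (a • u)⟫_ℂ = (s : ℂ) * ⟪w', a • u⟫_ℂ := by
      rw [map_smul, inner_smul_right, ← adjoint_inner_right, hMu, inner_smul_right,
        inner_smul_right]
      ring
    have hcross' : (⟪T w', T (a • u)⟫_ℂ).re = s * (⟪w', a • u⟫_ℂ).re := by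
      rw [hcross, Complex.re_ofReal_mul]
    have e1 : ‖w‖ ^ 2 = ‖w'‖ ^ 2 + 2 * (⟪w', a • u⟫_ℂ).re + ‖a • u‖ ^ 2 := by
      rw [hw]; exact norm_add_sq (𝕜 := ℂ) _ _
    have e2 : ‖T w‖ ^ 2 = ‖T w'‖ ^ 2 + 2 * (⟪T w', T (a • u)⟫_ℂ).re + ‖T (a • u)‖ ^ 2 := by
      rw [hw, map_add]; exact norm_add_sq (𝕜 := ℂ) _ _
    have e3 : ‖T (a • u)‖ ^ 2 = s * ‖a • u‖ ^ 2 := by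
      rw [map_smul, norm_smul, norm_smul, mul_pow, mul_pow, hTu]; ring
    rw [e1, e2, e3, hcross']
    have : 0 ≤ c * ‖w'‖ ^ 2 := by positivity
    simp only [norm_zero] at h2
    nlinarith
  refine ⟨h1, ?_, hMu, fun w hw => ?_⟩
  · have hle : Real.sqrt s ≤ sigmaMin T := by
      refine le_sigmaMin fun w => ?_
      refine le_of_sq_le_sq ?_ (norm_nonneg _)
      rw [mul_pow, Real.sq_sqrt hs]
      exact hlow w
    have h3 : s ≤ sigmaMin T ^ 2 := by
      rw [← Real.sq_sqrt hs]
      exact pow_le_pow_left₀ (Real.sqrt_nonneg _) hle 2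
    have h4 := sigmaMin_sq_mul_le T u
    rw [hTu] at h4
    exact le_antisymm (le_of_mul_le_mul_right h4 hun) h3
  · have h2 : borderedGram e T s (w - ⟪e, w⟫_ℂ • u) = 0 := by
      rw [map_sub, map_smul, hu, borderedGram_apply, hw]
      simp
    have h3 := hpd (w - ⟪e, w⟫_ℂ • u)
    rw [h2, inner_zero_left, Complex.zero_re] at h3
    have h4 : ‖w - ⟪e, w⟫_ℂ • u‖ ^ 2 ≤ 0 := by
      by_contra! h; nlinarith
    have h5 : ‖w - ⟪e, w⟫_ℂ • u‖ = 0 := by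
      have := norm_nonneg (w - ⟪e, w⟫_ℂ • u)
      nlinarith
    exact sub_eq_zero.1 (norm_eq_zero.1 h5)

/-- At a simple smallest singular value the bordered Gram operator is positive definite. -/
lemma exists_borderedGram_pos [Nontrivial H] {T : H →L[ℂ] H}
    (hsimple : IsSimpleSingularValue T (sigmaMin T)) :
    ∃ e : H, ‖e‖ = 1 ∧ adjoint T (T e) = ((sigmaMin T ^ 2 : ℝ) : ℂ) • e ∧
      ∃ c > 0, ∀ w, c * ‖w‖ ^ 2 ≤ (⟪borderedGram e T (sigmaMin T ^ 2) w, w⟫_ℂ).re := by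
  obtain ⟨hrank, ε, hε, hiso⟩ := hsimple
  obtain ⟨e', he'0, he'⟩ := finrank_eq_one_iff'.1 hrank
  set e : H := ((‖(e' : H)‖⁻¹ : ℝ) : ℂ) • (e' : H) with he_def
  have hn0 : 0 < ‖(e' : H)‖ := norm_pos_iff.2 (by simpa using he'0)
  have he1 : ‖e‖ = 1 := by
    rw [he_def, norm_smul, Complex.norm_real, Real.norm_of_nonneg (by positivity),
      inv_mul_cancel₀ hn0.ne']
  have hmem : ∀ w : H, w ∈ Module.End.eigenspace
      (((adjoint T).comp T : H →L[ℂ] H) : H →ₗ[ℂ] H) ((sigmaMin T : ℂ) ^ 2) ↔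
      adjoint T (T w) = ((sigmaMin T ^ 2 : ℝ) : ℂ) • w := by
    intro w
    rw [Module.End.mem_eigenspace_iff]
    simp
  have heT : adjoint T (T e) = ((sigmaMin T ^ 2 : ℝ) : ℂ) • e :=
    (hmem e).1 (Submodule.smul_mem _ _ e'.2)
  -- The spectral gap gives `ε` on the complement of `e`; the border gives `1` along `e`.
  refine ⟨e, he1, heT, min ε 1, by positivity, fun w => ?_⟩
  have hsa : IsSelfAdjoint ((adjoint T).comp T) := by
    rw [← ContinuousLinearMap.star_eq_adjoint]
    exact IsSelfAdjoint.star_mul_self T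
  have heig : ∀ w, ((adjoint T).comp T) w = ((sigmaMin T ^ 2 : ℝ) : ℂ) • w → w = ⟪e, w⟫_ℂ • e := by
    intro w hw
    obtain ⟨c, hc⟩ := he' ⟨w, (hmem w).2 hw⟩
    have hc' : c • (e' : H) = w := congrArg Subtype.val hc
    have h1 : (e' : H) = ((‖(e' : H)‖ : ℝ) : ℂ) • e := by
      rw [he_def, smul_smul, ← Complex.ofReal_mul, mul_inv_cancel₀ hn0.ne', Complex.ofReal_one,
        one_smul]
    rw [h1, smul_smul] at hc'
    rw [← hc', inner_smul_right, inner_self_eq_norm_sq_to_K, he1]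
    simp
  have hgap := quadraticForm_gap hsa hε (s := sigmaMin T ^ 2)
    (fun w => by rw [comp_apply, re_inner_adjoint_comp_self]; exact sigmaMin_sq_mul_le T w)
    (fun t ht h => by
      have := hiso t ht (by simpa using h)
      simpa using this) he1 heig w
  rw [comp_apply, re_inner_adjoint_comp_self] at hgap
  rw [re_inner_borderedGram]
  have h1 : ‖⟪e, w⟫_ℂ‖ ^ 2 ≤ ‖w‖ ^ 2 := by
    refine pow_le_pow_left₀ (norm_nonneg _) ?_ 2
    simpa [he1] using norm_inner_le_norm (𝕜 := ℂ) e w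
  have h2 : min ε 1 ≤ ε := min_le_left _ _
  have h3 : min ε 1 ≤ 1 := min_le_right _ _
  nlinarith [mul_nonneg (sub_nonneg.2 h2) (sub_nonneg.2 h1),
    mul_nonneg (sub_nonneg.2 h3) (sq_nonneg ‖⟪e, w⟫_ℂ‖)]

end BorderedGram

/-! ### Smooth dependence of a simple singular pair -/

section SmoothSingularPair

variable {H : Type*} [NormedAddCommGroup H] [InnerProductSpace ℂ H] [CompleteSpace H]

lemma contDiffAt_borderedGram {E : Type*} [NormedAddCommGroup E] [NormedSpace ℝ E]
    {n : WithTop ℕ∞} {T : E → H →L[ℂ] H} {p₀ : E} (hT : ContDiffAt ℝ n T p₀) (e : H) (s₀ : ℝ) :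
    ContDiffAt ℝ n (fun q : E × ℝ => borderedGram e (T q.1) q.2) (p₀, s₀) := by
  have hT1 : ContDiffAt ℝ n (fun q : E × ℝ => T q.1) (p₀, s₀) :=
    ContDiffAt.comp (p₀, s₀) (g := T) (f := Prod.fst) hT contDiffAt_fst
  have hTs : ContDiffAt ℝ n (fun q : E × ℝ => star (T q.1)) (p₀, s₀) :=
    ((starL' ℝ : (H →L[ℂ] H) ≃L[ℝ] (H →L[ℂ] H)).contDiff.contDiffAt).comp (p₀, s₀) hT1
  unfold borderedGram
  exact ((hTs.mul hT1).sub (contDiffAt_snd.smul contDiffAt_const)).add contDiffAt_const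

/-- The solution of `G q w = e` depends smoothly on `q` near a positive definite `G q₀`. -/
lemma exists_contDiffAt_solution {X : Type*} [NormedAddCommGroup X] [NormedSpace ℝ X]
    {n : WithTop ℕ∞} {G : X → H →L[ℂ] H} {q₀ : X} (hG : ContDiffAt ℝ n G q₀) {c : ℝ} (hc : 0 < c)
    (hpd : ∀ w, c * ‖w‖ ^ 2 ≤ (⟪G q₀ w, w⟫_ℂ).re) (e : H) :
    ∃ U : X → H, ContDiffAt ℝ n U q₀ ∧ ∀ᶠ q in 𝓝 q₀,
      (∀ w, c / 2 * ‖w‖ ^ 2 ≤ (⟪G q w, w⟫_ℂ).re) ∧ G q (U q) = e ∧ ∀ w, G q w = e → w = U q := by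
  have hpd' : ∀ᶠ q in 𝓝 q₀, ∀ w, c / 2 * ‖w‖ ^ 2 ≤ (⟪G q w, w⟫_ℂ).re := by
    have h1 := Metric.tendsto_nhds.1 hG.continuousAt (c / 2) (by positivity)
    filter_upwards [h1] with q hq w
    rw [dist_eq_norm] at hq
    have h2 := hpd w
    have h3 : (⟪(G q - G q₀) w, w⟫_ℂ).re = (⟪G q w, w⟫_ℂ).re - (⟪G q₀ w, w⟫_ℂ).re := by
      rw [sub_apply, inner_sub_left, Complex.sub_re]
    have h4 : |(⟪(G q - G q₀) w, w⟫_ℂ).re| ≤ c / 2 * ‖w‖ ^ 2 := by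
      calc _ ≤ ‖⟪(G q - G q₀) w, w⟫_ℂ‖ := Complex.abs_re_le_norm _
        _ ≤ ‖(G q - G q₀) w‖ * ‖w‖ := norm_inner_le_norm _ _
        _ ≤ (‖G q - G q₀‖ * ‖w‖) * ‖w‖ := by gcongr; exact le_opNorm _ _
        _ ≤ c / 2 * ‖w‖ ^ 2 := by rw [mul_assoc, ← sq]; gcongr
    have := (abs_le.1 h4).1
    linarith
  -- Coercivity gives invertibility (Lax–Milgram), and inversion is smooth on units.
  have hunit : ∀ q, (∀ w, c / 2 * ‖w‖ ^ 2 ≤ (⟪G q w, w⟫_ℂ).re) → IsUnit (G q) := by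
    intro q hq
    refine isUnit_of_forall_le_norm_inner_map _ (c := (c / 2).toNNReal)
      (Real.toNNReal_pos.2 (half_pos hc)) fun w => ?_
    rw [mul_comm, Real.coe_toNNReal _ (half_pos hc).le]
    exact (hq w).trans (Complex.re_le_norm _)
  refine ⟨fun q => Ring.inverse (G q) e, ?_, ?_⟩
  · obtain ⟨g, hg⟩ := hunit _ hpd'.self_of_nhds
    have h1 : ContDiffAt ℝ n (Ring.inverse : (H →L[ℂ] H) → _) (G q₀) := by
      rw [← hg]; exact contDiffAt_ringInverse ℝ g
    have h2 := h1.comp q₀ hG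
    have h3 : ContDiff ℝ n (fun L : H →L[ℂ] H => L e) :=
      ((ContinuousLinearMap.apply ℂ H e).restrictScalars ℝ).contDiff
    exact h3.contDiffAt.comp q₀ h2
  · filter_upwards [hpd'] with q hq
    refine ⟨hq, ?_, fun w hw => ?_⟩
    · exact congrArg (fun L : H →L[ℂ] H => L e) (Ring.mul_inverse_cancel _ (hunit q hq))
    · have h : Ring.inverse (G q) (G q w) = w :=
        congrArg (fun L : H →L[ℂ] H => L w) (Ring.inverse_mul_cancel _ (hunit q hq))
      rw [← hw, h]

/-- Near a parameter at which the smallest singular value is positive and simple, the smallest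
singular value and a suitably normalized right singular vector depend smoothly on the parameter. -/
theorem exists_contDiffAt_singular_pair [Nontrivial H] {E : Type*} [NormedAddCommGroup E]
    [NormedSpace ℝ E] [CompleteSpace E] {n : WithTop ℕ∞} (hn : n ≠ 0) {T : E → H →L[ℂ] H} {p₀ : E}
    (hT : ContDiffAt ℝ n T p₀) (hpos : 0 < sigmaMin (T p₀))
    (hsimple : IsSimpleSingularValue (T p₀) (sigmaMin (T p₀))) :
    ∃ (e : H) (u : E → H), ‖e‖ = 1 ∧ ContDiffAt ℝ n u p₀ ∧
      ContDiffAt ℝ n (fun p => sigmaMin (T p)) p₀ ∧ ∀ᶠ p in 𝓝 p₀, ⟪e, u p⟫_ℂ = 1 ∧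
        adjoint (T p) (T p (u p)) = ((sigmaMin (T p) ^ 2 : ℝ) : ℂ) • u p ∧
        ∀ w, adjoint (T p) (T p w) = ((sigmaMin (T p) ^ 2 : ℝ) : ℂ) • w →
          w = ⟪e, w⟫_ℂ • u p := by
  obtain ⟨e, he, heT, c, hc, hpd⟩ := exists_borderedGram_pos hsimple
  set s₀ := sigmaMin (T p₀) ^ 2 with hs₀
  have hGc := contDiffAt_borderedGram hT e s₀
  obtain ⟨U, hUc, hU⟩ := exists_contDiffAt_solution hGc hc hpd e
  -- The eigenvalue problem becomes one scalar equation in `s`: the solution of `G w = e` must have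
  -- `e`-coefficient `1`.
  set φ : E × ℝ → ℝ := fun q => (⟪e, U q⟫_ℂ).re - 1 with hφ
  have hφc : ContDiffAt ℝ n φ (p₀, s₀) := by
    have h1 : ContDiff ℝ n (fun w : H => (⟪e, w⟫_ℂ).re) :=
      (Complex.reCLM.comp ((innerSL ℂ e).restrictScalars ℝ)).contDiff
    exact (h1.contDiffAt.comp (p₀, s₀) hUc).sub contDiffAt_const
  have hline : Tendsto (fun s : ℝ => (p₀, s)) (𝓝 s₀) (𝓝 (p₀, s₀)) :=
    (Continuous.prodMk_right p₀).tendsto s₀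
  -- At `p₀` the vector `e` is an eigenvector of `G` for `1 + s₀ - s`, so `φ (p₀, s) = (1 + s₀ -
  -- s)⁻¹ - 1`, with derivative `1` at `s₀`.
  have hUline : ∀ᶠ s in 𝓝 s₀, U (p₀, s) = ((1 + s₀ - s : ℝ) : ℂ)⁻¹ • e := by
    have h1 : ∀ᶠ s in 𝓝 s₀, 0 < 1 + s₀ - s :=
      (by fun_prop : Continuous fun s : ℝ => 1 + s₀ - s).continuousAt.eventually_const_lt (by simp)
    filter_upwards [hline.eventually hU, h1] with s hs h1
    refine (hs.2.2 _ ?_).symm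
    have h2 : borderedGram e (T p₀) s e = ((1 + s₀ - s : ℝ) : ℂ) • e := by
      simp only [borderedGram_apply, heT, inner_self_eq_norm_sq_to_K, he]
      rw [← sub_smul, ← add_smul]
      congr 1
      push_cast
      simp
      ring
    rw [map_smul, h2, smul_smul, inv_mul_cancel₀ (by exact_mod_cast h1.ne'), one_smul]
  have hφline : (fun s => φ (p₀, s)) =ᶠ[𝓝 s₀] fun s => (1 + s₀ - s)⁻¹ - 1 := by
    filter_upwards [hUline] with s hs
    simp only [hφ, hs, inner_smul_right, inner_self_eq_norm_sq_to_K, he]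
    rw [← Complex.ofReal_inv, Complex.re_ofReal_mul]
    simp
  have hφd : HasDerivAt (fun s => φ (p₀, s)) 1 s₀ := by
    refine HasDerivAt.congr_of_eventuallyEq ?_ hφline
    have h1 : HasDerivAt (fun s : ℝ => 1 + s₀ - s) (-1) s₀ := (hasDerivAt_id s₀).const_sub _
    have h2 := (h1.fun_inv (by simp)).sub_const (1 : ℝ)
    simpa using h2
  have hφ0 : φ (p₀, s₀) = 0 := by simpa using hφline.self_of_nhds
  obtain ⟨ψ, hψc, hψ0, hψ⟩ := exists_implicit_scalar hn hφc hφ0 hφd one_ne_zero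
  have hgraph : ContDiffAt ℝ n (fun p => (p, ψ p)) p₀ := contDiffAt_id.prodMk hψc
  have hgt : Tendsto (fun p => (p, ψ p)) (𝓝 p₀) (𝓝 (p₀, s₀)) := by
    have := hgraph.continuousAt.tendsto
    rwa [hψ0] at this
  have hmain : ∀ᶠ p in 𝓝 p₀, ⟪e, U (p, ψ p)⟫_ℂ = 1 ∧ sigmaMin (T p) ^ 2 = ψ p ∧
      adjoint (T p) (T p (U (p, ψ p))) = (ψ p : ℂ) • U (p, ψ p) ∧
      ∀ w, adjoint (T p) (T p w) = (ψ p : ℂ) • w → w = ⟪e, w⟫_ℂ • U (p, ψ p) := by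
    filter_upwards [hgt.eventually hU, hψ] with p hp hp0
    refine singular_pair_of_borderedGram (half_pos hc) hp.1 hp.2.1 ?_
    simp only [hφ] at hp0
    linarith
  refine ⟨e, fun p => U (p, ψ p), he, ?_, ?_, ?_⟩
  · rw [← hψ0] at hUc
    exact hUc.comp p₀ hgraph
  · have h1 : (fun p => sigmaMin (T p)) =ᶠ[𝓝 p₀] fun p => Real.sqrt (ψ p) := by
      filter_upwards [hmain] with p hp
      rw [← hp.2.1, Real.sqrt_sq (sigmaMin_nonneg _)]
    -- Positivity of the singular value keeps the square root away from its singularity.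
    refine ContDiffAt.congr_of_eventuallyEq (hψc.sqrt ?_) h1
    rw [hψ0, hs₀]
    positivity
  · filter_upwards [hmain] with p ⟨h1, h2, h3, h4⟩
    rw [h2]
    exact ⟨h1, h3, h4⟩

end SmoothSingularPair

/-! ### Dependence on the frequency -/

section Shift

variable {H : Type*} [NormedAddCommGroup H] [InnerProductSpace ℂ H]

lemma imShift_sub_imShift (S T : H →L[ℂ] H) (w : ℝ) : imShift S w - imShift T w = S - T := by
  simp [imShift]

lemma norm_imShift_sub_imShift_le (T : H →L[ℂ] H) (v w : ℝ) :
    ‖imShift T v - imShift T w‖ ≤ |v - w| := by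
  have h : imShift T v - imShift T w
      = (((w - v : ℝ) : ℂ) * Complex.I) • ContinuousLinearMap.id ℂ H := by
    simp only [imShift, sub_sub_sub_cancel_left, ← sub_smul]
    push_cast
    ring_nf
  rw [h, norm_smul, norm_mul, Complex.norm_I, Complex.norm_real, mul_one, Real.norm_eq_abs,
    abs_sub_comm]
  exact mul_le_of_le_one_right (abs_nonneg _) ContinuousLinearMap.norm_id_le

variable [Nontrivial H]

lemma abs_sigmaMin_imShift_sub_le (S T : H →L[ℂ] H) (w : ℝ) :
    |sigmaMin (imShift S w) - sigmaMin (imShift T w)| ≤ ‖S - T‖ := by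
  simpa [imShift_sub_imShift] using abs_sigmaMin_sub_le (imShift S w) (imShift T w)

lemma continuous_sigmaMin_imShift (T : H →L[ℂ] H) :
    Continuous fun w => sigmaMin (imShift T w) := by
  refine LipschitzWith.continuous (K := 1) (LipschitzWith.of_dist_le_mul fun v w => ?_)
  rw [Real.dist_eq, Real.dist_eq, NNReal.coe_one, one_mul]
  exact (abs_sigmaMin_sub_le _ _).trans (norm_imShift_sub_imShift_le T v w)

lemma abs_sub_norm_le_sigmaMin_imShift (T : H →L[ℂ] H) (w : ℝ) :
    |w| - ‖T‖ ≤ sigmaMin (imShift T w) := by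
  refine le_sigmaMin fun v => ?_
  have h1 : ‖((w : ℂ) * Complex.I) • v‖ = |w| * ‖v‖ := by
    rw [norm_smul, norm_mul, Complex.norm_I, Complex.norm_real, mul_one, Real.norm_eq_abs]
  have h2 : ‖((w : ℂ) * Complex.I) • v‖ ≤ ‖T v‖ + ‖imShift T w v‖ := by
    have : ((w : ℂ) * Complex.I) • v = T v - imShift T w v := by simp [imShift]
    rw [this]
    exact norm_sub_le _ _
  have h3 := T.le_opNorm v
  linarith [sub_mul |w| ‖T‖ ‖v‖]

/-- A strict global minimizer of `σ_min` over the imaginary axis is strict uniformly away from the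
minimizer, also for perturbed operators. -/
lemma exists_sigmaMin_imShift_gap {T₀ : H →L[ℂ] H} {b : ℝ}
    (hb : ∀ w, w ≠ b → sigmaMin (imShift T₀ b) < sigmaMin (imShift T₀ w)) {δ : ℝ} (hδ : 0 < δ) :
    ∃ η > 0, ∀ T : H →L[ℂ] H, ‖T - T₀‖ < η → ∀ w, δ ≤ |w - b| →
      sigmaMin (imShift T₀ b) + η < sigmaMin (imShift T w) := by
  set σ₀ := sigmaMin (imShift T₀ b)
  -- For `|w| > R` the bound `|w| - ‖T₀‖` already exceeds `σ₀ + 1`, leaving a compact set of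
  -- frequencies.
  set R := ‖T₀‖ + σ₀ + 1 with hR
  have hcpt : IsCompact (Set.Icc (-R) R ∩ {w | δ ≤ |w - b|}) :=
    isCompact_Icc.inter_right (isClosed_le (by fun_prop) (by fun_prop))
  obtain ⟨m, hm, hmle⟩ : ∃ m > 0, ∀ w ∈ Set.Icc (-R) R ∩ {w | δ ≤ |w - b|},
      σ₀ + m ≤ sigmaMin (imShift T₀ w) := by
    rcases (Set.Icc (-R) R ∩ {w | δ ≤ |w - b|}).eq_empty_or_nonempty with hemp | hne
    · exact ⟨1, one_pos, by simp [hemp]⟩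
    · obtain ⟨w₀, hw₀, hmin⟩ :=
        hcpt.exists_isMinOn hne (continuous_sigmaMin_imShift T₀).continuousOn
      refine ⟨sigmaMin (imShift T₀ w₀) - σ₀, sub_pos.2 (hb _ ?_), fun w hw => ?_⟩
      · rintro rfl
        have := hw₀.2
        simp only [Set.mem_ofPred_eq, sub_self, abs_zero] at this
        linarith
      · have := hmin hw
        simp only [Set.mem_ofPred_eq] at this
        linarith
  -- One third of the gap is spent on the perturbation of `T₀`, one third is the margin claimed, and
  -- the rest keeps the inequality strict.
  refine ⟨min m 1 / 3, by positivity, fun T hT w hw => ?_⟩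
  have h1 : σ₀ + min m 1 ≤ sigmaMin (imShift T₀ w) := by
    by_cases hwR : w ∈ Set.Icc (-R) R
    · linarith [hmle w ⟨hwR, hw⟩, min_le_left m 1]
    · have h2 : R < |w| := by
        rw [Set.mem_Icc, ← abs_le] at hwR
        exact not_le.1 hwR
      linarith [abs_sub_norm_le_sigmaMin_imShift T₀ w, min_le_right m 1]
  have h2 := (abs_le.1 (abs_sigmaMin_imShift_sub_le T T₀ w)).1
  have h3 : 0 < min m 1 := by positivity
  linarith

end Shift

/-! ### The distance to instability as a minimum over the imaginary axis -/

section Distance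

variable {H : Type*} [NormedAddCommGroup H] [InnerProductSpace ℂ H]

lemma distInstab_le_norm {T Δ : H →L[ℂ] H} {z : ℂ} (hz : 0 ≤ z.re)
    (h : z ∈ spectrum ℂ (T + Δ)) : distInstab T ≤ ‖Δ‖ :=
  csInf_le ⟨0, by rintro r ⟨Δ, rfl, -⟩; exact norm_nonneg _⟩ ⟨Δ, rfl, z, hz, h⟩

/-- For a unit vector `u`, the rank-one perturbation `-⟪u, ·⟫ (T - iw)u` has norm `‖(T - iw)u‖` and
turns `u` into an eigenvector for `iw`. -/
lemma distInstab_le_sigmaMin [Nontrivial H] (T : H →L[ℂ] H) (w : ℝ) :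
    distInstab T ≤ sigmaMin (imShift T w) := by
  obtain ⟨v, hv⟩ := NormedSpace.exists_lt_norm ℂ H 0
  refine le_csInf ⟨_, ((‖v‖⁻¹ : ℝ) : ℂ) • v, ?_, rfl⟩ ?_
  · rw [norm_smul, Complex.norm_real, Real.norm_of_nonneg (by positivity), inv_mul_cancel₀ hv.ne']
  rintro r ⟨u, hu, rfl⟩
  set Δ : H →L[ℂ] H := -InnerProductSpace.rankOne ℂ (imShift T w u) u with hΔ
  have hΔn : ‖Δ‖ = ‖imShift T w u‖ := by
    rw [hΔ, norm_neg, InnerProductSpace.norm_rankOne, hu, mul_one]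
  rw [← hΔn]
  refine distInstab_le_norm (z := (w : ℂ) * Complex.I) (by simp) ?_
  rw [spectrum.mem_iff]
  rintro ⟨g, hg⟩
  have h0 : (algebraMap ℂ (H →L[ℂ] H) ((w : ℂ) * Complex.I) - (T + Δ)) u = 0 := by
    simp [hΔ, imShift, Algebra.algebraMap_eq_smul_one, inner_self_eq_norm_sq_to_K, hu]
  rw [← hg] at h0
  have h1 : (g⁻¹.val * g.val : H →L[ℂ] H) u = 0 := by
    change g⁻¹.val (g.val u) = 0
    rw [h0, map_zero]
  rw [Units.inv_mul] at h1
  have : u = 0 := h1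
  simp [this] at hu

lemma notMem_spectrum_of_norm_sub_lt {T₀ T : H →L[ℂ] H} (h : ‖T - T₀‖ < distInstab T₀) {z : ℂ}
    (hz : 0 ≤ z.re) : z ∉ spectrum ℂ T := fun hmem =>
  absurd (distInstab_le_norm (T := T₀) (Δ := T - T₀) hz (by simpa using hmem)) (not_le.2 h)

variable [CompleteSpace H]

/-- The resolvent of an operator with spectrum in the open left half-plane is bounded on the right
half-plane by its bound on the imaginary axis. -/
lemma norm_resolvent_le_of_le_sigmaMin {T : H →L[ℂ] H} {γ : ℝ} (hγ : 0 < γ)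
    (hσ : ∀ w, γ ≤ sigmaMin (imShift T w)) (hspec : ∀ z : ℂ, 0 ≤ z.re → z ∉ spectrum ℂ T)
    {z : ℂ} (hz : 0 ≤ z.re) : ‖resolvent T z‖ ≤ γ⁻¹ := by
  have hax : ∀ w : ℂ, w.re = 0 → ‖resolvent T w‖ ≤ γ⁻¹ := by
    intro w hw
    have hunit : IsUnit (algebraMap ℂ (H →L[ℂ] H) w - T) :=
      spectrum.notMem_iff.1 (hspec w hw.ge)
    refine opNorm_le_bound _ (by positivity) fun v => ?_
    have h1 : (algebraMap ℂ (H →L[ℂ] H) w - T) (resolvent T w v) = v :=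
      congrArg (fun L : H →L[ℂ] H => L v) (Ring.mul_inverse_cancel _ hunit)
    have hw' : w = (w.im : ℂ) * Complex.I := by
      apply Complex.ext <;> simp [hw]
    have h2 : imShift T w.im (resolvent T w v) = -v := by
      have h : imShift T w.im = -(algebraMap ℂ (H →L[ℂ] H) w - T) := by
        rw [imShift, ← hw', Algebra.algebraMap_eq_smul_one, neg_sub]
        rfl
      rw [h, neg_apply, h1]
    have h3 := sigmaMin_mul_norm_le (imShift T w.im) (resolvent T w v)
    rw [h2, norm_neg] at h3
    rw [inv_mul_eq_div, le_div_iff₀ hγ, mul_comm]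
    exact (mul_le_mul_of_nonneg_right (hσ _) (norm_nonneg _)).trans h3
  -- The resolvent vanishes at infinity, so on a large half-disc the bound holds on the arc as well
  -- as on the diameter, and the maximum principle applies.
  obtain ⟨r, hr⟩ : ∃ r : ℝ, ∀ w : ℂ, r ≤ ‖w‖ → ‖resolvent T w‖ ≤ γ⁻¹ := by
    have h1 := (spectrum.resolvent_tendsto_cobounded (𝕜 := ℂ) T).norm
    rw [norm_zero] at h1
    have h2 := h1.eventually_lt_const (inv_pos.2 hγ)
    rw [← comap_norm_atTop, eventually_comap] at h2
    obtain ⟨r, hr⟩ := eventually_atTop.1 h2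
    exact ⟨r, fun w hw => (hr _ hw w rfl).le⟩
  set R := max r (‖z‖ + 1) with hR
  have hR0 : 0 < R := lt_of_lt_of_le (by positivity) (le_max_right _ _)
  set U : Set ℂ := {w | 0 < w.re} ∩ Metric.ball 0 R with hU
  have hcl : closure U ⊆ {w | 0 ≤ w.re} := by
    refine closure_minimal (fun w hw => (show 0 < w.re from hw.1).le) ?_
    exact isClosed_le continuous_const Complex.continuous_re
  have hdiff : ∀ w : ℂ, 0 ≤ w.re → DifferentiableAt ℂ (resolvent T) w := fun w hw =>
    (spectrum.hasDerivAt_resolvent_const_left (spectrum.notMem_iff.1 (hspec w hw))).differentiableAt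
  refine Complex.norm_le_of_forall_mem_frontier_norm_le (U := U)
    (Metric.isBounded_ball.subset Set.inter_subset_right) ?_ ?_ ?_
  · refine DifferentiableOn.diffContOnCl fun w hw => (hdiff w (hcl hw)).differentiableWithinAt
  · intro w hw
    rcases frontier_inter_subset _ _ hw with h | h
    · have h1 := h.1
      rw [Complex.frontier_setOfPred_lt_re] at h1
      exact hax w h1
    · have h1 := Metric.frontier_ball_subset_sphere h.2
      refine hr w ?_
      rw [mem_sphere_zero_iff_norm.1 h1]
      exact le_max_left _ _
  · have hzR : z ∈ Metric.ball (0 : ℂ) R := by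
      rw [mem_ball_zero_iff]
      exact lt_of_lt_of_le (lt_add_one _) (le_max_right _ _)
    -- `z` may lie on the imaginary axis, outside the open half-disc; it is approached from the
    -- right.
    have hlim : Tendsto (fun t : ℝ => z + (t : ℂ)) (𝓝[>] 0) (𝓝 z) := by
      have h : Continuous fun t : ℝ => z + (t : ℂ) := by fun_prop
      simpa using (h.tendsto 0).mono_left nhdsWithin_le_nhds
    refine mem_closure_of_tendsto hlim ?_
    filter_upwards [hlim.eventually (Metric.isOpen_ball.mem_nhds hzR), self_mem_nhdsWithin]
      with t h1 h2
    refine ⟨?_, h1⟩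
    have h3 : 0 < t := h2
    have h4 : 0 < (z + (t : ℂ)).re := by simp; linarith
    exact h4

/-- If `‖Δ‖ < γ`, then `z - (T + Δ) = (z - T)(1 - (z - T)⁻¹ Δ)` is invertible by a Neumann series,
thanks to the resolvent bound on the half-plane. -/
lemma le_distInstab [Nontrivial H] {T : H →L[ℂ] H} {γ : ℝ} (hγ : 0 < γ)
    (hσ : ∀ w, γ ≤ sigmaMin (imShift T w)) (hspec : ∀ z : ℂ, 0 ≤ z.re → z ∉ spectrum ℂ T) :
    γ ≤ distInstab T := by
  refine le_csInf ⟨‖-T‖, -T, rfl, 0, by simp, by simp⟩ ?_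
  rintro r ⟨Δ, rfl, z, hz, hmem⟩
  by_contra! hlt
  refine hmem ?_
  have hunit : IsUnit (algebraMap ℂ (H →L[ℂ] H) z - T) := spectrum.notMem_iff.1 (hspec z hz)
  have h1 : (algebraMap ℂ (H →L[ℂ] H) z - T) * resolvent T z = 1 :=
    Ring.mul_inverse_cancel _ hunit
  have h2 : algebraMap ℂ (H →L[ℂ] H) z - (T + Δ)
      = (algebraMap ℂ (H →L[ℂ] H) z - T) * (1 - resolvent T z * Δ) := by
    rw [mul_sub, ← mul_assoc, h1, mul_one, one_mul]
    abel
  change IsUnit _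
  rw [h2]
  refine hunit.mul (isUnit_one_sub_of_norm_lt_one ?_)
  calc ‖resolvent T z * Δ‖ ≤ ‖resolvent T z‖ * ‖Δ‖ := norm_mul_le _ _
    _ ≤ γ⁻¹ * ‖Δ‖ := by
      gcongr
      exact norm_resolvent_le_of_le_sigmaMin hγ hσ hspec hz
    _ < 1 := by rwa [inv_mul_lt_iff₀ hγ, mul_one]

end Distance

/-! ### Persistence of a nondegenerate partial minimizer -/

lemma contDiffAt_fderiv_apply_snd {S : ℝ × ℝ → ℝ} {q : ℝ × ℝ} {m : ℕ}
    (hS : ContDiffAt ℝ (m + 1 : ℕ) S q) :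
    ContDiffAt ℝ m (fun q => fderiv ℝ S q (0, 1)) q :=
  (hS.fderiv_right (m := m) (by norm_cast)).clm_apply contDiffAt_const

lemma hasDerivAt_comp_prodMk {S : ℝ × ℝ → ℝ} {x w : ℝ} (hS : DifferentiableAt ℝ S (x, w)) :
    HasDerivAt (fun w => S (x, w)) (fderiv ℝ S (x, w) (0, 1)) w := by
  have h1 : HasDerivAt (fun w : ℝ => (x, w)) ((0 : ℝ), (1 : ℝ)) w :=
    (hasDerivAt_const w x).prodMk (hasDerivAt_id w)
  exact hS.hasFDerivAt.comp_hasDerivAt w h1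

/-- A nondegenerate critical minimum in the second variable persists: near it the partial minimizer
is unique and depends smoothly on the first variable. -/
lemma exists_contDiffAt_minimizer {S : ℝ × ℝ → ℝ} {a b : ℝ} (hS : ContDiffAt ℝ 3 S (a, b))
    (h1 : deriv (fun w => S (a, w)) b = 0)
    (h2 : 0 < deriv (deriv fun w => S (a, w)) b) :
    ∃ ψ : ℝ → ℝ, ContDiffAt ℝ 2 ψ a ∧ ψ a = b ∧ ∃ δ > 0, ∀ᶠ x in 𝓝 a, ∀ w, |w - b| < δ →
      S (x, ψ x) ≤ S (x, w) ∧ (S (x, w) ≤ S (x, ψ x) → w = ψ x) := by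
  set S₁ : ℝ × ℝ → ℝ := fun q => fderiv ℝ S q (0, 1) with hS₁
  set S₂ : ℝ × ℝ → ℝ := fun q => fderiv ℝ S₁ q (0, 1) with hS₂
  have hc1 : ContDiffAt ℝ 2 S₁ (a, b) := contDiffAt_fderiv_apply_snd (m := 2) (by exact_mod_cast hS)
  have hc2 : ContDiffAt ℝ 1 S₂ (a, b) :=
    contDiffAt_fderiv_apply_snd (m := 1) (by exact_mod_cast hc1)
  have hd : ∀ᶠ q in 𝓝 (a, b), HasDerivAt (fun w => S (q.1, w)) (S₁ q) q.2 := by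
    filter_upwards [hS.eventually (by simp)] with q hq
    exact hasDerivAt_comp_prodMk (hq.differentiableAt (by simp))
  have hd1 : ∀ᶠ q in 𝓝 (a, b), HasDerivAt (fun w => S₁ (q.1, w)) (S₂ q) q.2 := by
    filter_upwards [hc1.eventually (by simp)] with q hq
    exact hasDerivAt_comp_prodMk (hq.differentiableAt (by simp))
  have hline : Tendsto (fun w : ℝ => (a, w)) (𝓝 b) (𝓝 (a, b)) :=
    (Continuous.prodMk_right a).tendsto b
  have hS1b : S₁ (a, b) = 0 := by rw [← h1]; exact (hd.self_of_nhds.deriv).symm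
  have hS2b : 0 < S₂ (a, b) := by
    have h3 : deriv (fun w => S (a, w)) =ᶠ[𝓝 b] fun w => S₁ (a, w) := by
      filter_upwards [hline.eventually hd] with w hw using hw.deriv
    rw [h3.deriv_eq] at h2
    rwa [hd1.self_of_nhds.deriv] at h2
  obtain ⟨ψ, hψc, hψ0, hψ⟩ := exists_implicit_scalar (n := 2) (by simp) hc1 hS1b
    hd1.self_of_nhds hS2b.ne'
  have hall := (hd.and hd1).and (hc2.continuousAt.eventually_const_lt hS2b)
  obtain ⟨δ, hδ, hball⟩ := Metric.eventually_nhds_iff.1 hall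
  refine ⟨ψ, hψc, hψ0, δ, hδ, ?_⟩
  have hψδ : ∀ᶠ x in 𝓝 a, |ψ x - b| < δ := by
    have := Metric.tendsto_nhds.1 hψc.continuousAt δ hδ
    rwa [hψ0] at this
  have hxδ : ∀ᶠ x in 𝓝 a, |x - a| < δ := Metric.tendsto_nhds.1 tendsto_id δ hδ
  filter_upwards [hψ, hψδ, hxδ] with x hx hxψ hxa
  have hbox : ∀ w ∈ Set.Ioo (b - δ) (b + δ),
      (HasDerivAt (fun w => S (x, w)) (S₁ (x, w)) w ∧
        HasDerivAt (fun w => S₁ (x, w)) (S₂ (x, w)) w) ∧ 0 < S₂ (x, w) := by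
    intro w hw
    refine hball (y := (x, w)) ?_
    rw [Prod.dist_eq, max_lt_iff]
    refine ⟨hxa, ?_⟩
    rw [Real.dist_eq, abs_lt]
    constructor <;> linarith [hw.1, hw.2]
  have hmem : ∀ w, |w - b| < δ → w ∈ Set.Ioo (b - δ) (b + δ) := fun w hw => by
    rw [abs_lt] at hw
    constructor <;> linarith
  -- Strict convexity on a window independent of `x` makes the critical point `ψ x` the only
  -- minimizer there.
  have hconv : StrictConvexOn ℝ (Set.Ioo (b - δ) (b + δ)) fun w => S (x, w) := by
    refine strictConvexOn_of_deriv2_pos' (convex_Ioo _ _)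
      (fun w hw => (hbox w hw).1.1.continuousAt.continuousWithinAt) fun w hw => ?_
    have h3 : deriv (fun w => S (x, w)) =ᶠ[𝓝 w] fun w => S₁ (x, w) := by
      filter_upwards [isOpen_Ioo.mem_nhds hw] with w hw using (hbox w hw).1.1.deriv
    rw [Function.iterate_succ_apply, Function.iterate_one, h3.deriv_eq,
      (hbox w hw).1.2.deriv]
    exact (hbox w hw).2
  have hψm := hmem _ hxψ
  have hmin : IsMinOn (fun w => S (x, w)) (Set.Ioo (b - δ) (b + δ)) (ψ x) := by
    refine hconv.convexOn.isMinOn_of_rightDeriv_eq_zero (by rwa [interior_Ioo]) ?_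
    rw [((hbox _ hψm).1.1.hasDerivWithinAt).derivWithin (uniqueDiffWithinAt_Ioi _)]
    exact hx
  intro w hw
  refine ⟨hmin (hmem w hw), fun hle => ?_⟩
  refine hconv.eq_of_isMinOn (fun y hy => ?_) hmin (hmem w hw) hψm
  exact hle.trans (hmin hy)

lemma contDiffAt_comp_graph {F : Type*} [NormedAddCommGroup F] [NormedSpace ℝ F] {n : WithTop ℕ∞}
    {S : ℝ × ℝ → F} {ψ : ℝ → ℝ} {a b : ℝ} (hS : ContDiffAt ℝ n S (a, b)) (hψ : ContDiffAt ℝ n ψ a)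
    (hψ0 : ψ a = b) : ContDiffAt ℝ n (fun x => S (x, ψ x)) a := by
  subst hψ0
  exact hS.comp a (contDiffAt_id.prodMk hψ)

/-! ### Local structure of the distance along the operator family -/

section Family

variable {H : Type*} [NormedAddCommGroup H] [InnerProductSpace ℂ H]

lemma contDiffAt_imShift {n : WithTop ℕ∞} {A : ℝ → H →L[ℂ] H} {a : ℝ} (hA : ContDiffAt ℝ n A a)
    (b : ℝ) : ContDiffAt ℝ n (fun q : ℝ × ℝ => imShift (A q.1) q.2) (a, b) := by
  have h1 : ContDiffAt ℝ n (fun q : ℝ × ℝ => A q.1) (a, b) :=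
    ContDiffAt.comp (a, b) (g := A) (f := Prod.fst) hA contDiffAt_fst
  have h2 : ContDiff ℝ n fun q : ℝ × ℝ =>
      q.2 • (Complex.I • ContinuousLinearMap.id ℂ H : H →L[ℂ] H) :=
    contDiff_snd.smul contDiff_const
  have h3 : (fun q : ℝ × ℝ => imShift (A q.1) q.2) = fun q : ℝ × ℝ =>
      A q.1 - q.2 • (Complex.I • ContinuousLinearMap.id ℂ H : H →L[ℂ] H) := by
    funext q
    rw [imShift, ← Complex.coe_smul, smul_smul]
  rw [h3]
  exact h1.sub h2.contDiffAt

lemma contDiffAt_opFamily {n : WithTop ℕ∞} {κ : ℕ} {f : Fin κ → ℝ → ℝ} {a : ℝ}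
    (hf : ∀ j, ContDiffAt ℝ n (f j) a) (A : Fin κ → H →L[ℂ] H) :
    ContDiffAt ℝ n (opFamily f A) a := by
  have h : opFamily f A = fun x => ∑ j, f j x • A j := by
    funext x
    simp [opFamily]
  rw [h]
  exact ContDiffAt.sum fun j _ => (hf j).smul contDiffAt_const

/-- The data describing the distance to instability near a parameter `a` at which it is attained at
a single nondegenerate point `b` of the imaginary axis: a smooth minimizer `ψ` and a smooth
normalized right singular vector `u`. -/
theorem exists_local_structure [CompleteSpace H] [Nontrivial H] {A : ℝ → H →L[ℂ] H} {a b : ℝ}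
    (hA : ContDiffAt ℝ 3 A a)
    (hatt : distInstab (A a) = sigmaMin (imShift (A a) b))
    (huniq : ∀ w, distInstab (A a) = sigmaMin (imShift (A a) w) → w = b)
    (hpos : 0 < sigmaMin (imShift (A a) b))
    (hsimple : IsSimpleSingularValue (imShift (A a) b) (sigmaMin (imShift (A a) b)))
    (h2 : 0 < iteratedDeriv 2 (fun w => sigmaMin (imShift (A a) w)) b) :
    ∃ (e : H) (ψ : ℝ → ℝ) (u : ℝ → H), ‖e‖ = 1 ∧ ContDiffAt ℝ 2 ψ a ∧ ContDiffAt ℝ 2 u a ∧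
      ContDiffAt ℝ 2 (fun x => distInstab (A x)) a ∧ ∀ᶠ x in 𝓝 a,
        distInstab (A x) = sigmaMin (imShift (A x) (ψ x)) ∧
        (∀ w, distInstab (A x) ≤ sigmaMin (imShift (A x) w)) ∧
        (∀ w, sigmaMin (imShift (A x) w) ≤ distInstab (A x) → w = ψ x) ∧
        ⟪e, u x⟫_ℂ = 1 ∧
        adjoint (imShift (A x) (ψ x)) (imShift (A x) (ψ x) (u x)) =
          ((distInstab (A x) ^ 2 : ℝ) : ℂ) • u x ∧
        ∀ w, adjoint (imShift (A x) (ψ x)) (imShift (A x) (ψ x) w) =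
          ((distInstab (A x) ^ 2 : ℝ) : ℂ) • w → w = ⟪e, w⟫_ℂ • u x := by
  have hle : ∀ w, sigmaMin (imShift (A a) b) ≤ sigmaMin (imShift (A a) w) := fun w => by
    rw [← hatt]; exact distInstab_le_sigmaMin _ _
  have hlt : ∀ w, w ≠ b → sigmaMin (imShift (A a) b) < sigmaMin (imShift (A a) w) := fun w hw =>
    lt_of_le_of_ne (hle w) fun h => hw (huniq w (hatt.trans h))
  -- Three derivatives are needed because `ψ` solves `∂σ/∂ω = 0`, which costs one.
  obtain ⟨e, U, he, hUc, hSc, hU⟩ := exists_contDiffAt_singular_pair (n := 3) (by simp)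
    (T := fun q : ℝ × ℝ => imShift (A q.1) q.2) (p₀ := (a, b)) (contDiffAt_imShift hA b) hpos
    hsimple
  have hd1 : deriv (fun w => sigmaMin (imShift (A a) w)) b = 0 :=
    IsLocalMin.deriv_eq_zero (Eventually.of_forall hle)
  rw [iteratedDeriv_succ, iteratedDeriv_one] at h2
  obtain ⟨ψ, hψc, hψ0, δ, hδ, hψ⟩ := exists_contDiffAt_minimizer hSc hd1 h2
  have hAc := hA.continuousAt.tendsto
  have h23 : (2 : WithTop ℕ∞) ≤ 3 := by norm_num
  have hgt : Tendsto (fun x => (x, ψ x)) (𝓝 a) (𝓝 (a, b)) := by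
    have := (continuousAt_id.prodMk hψc.continuousAt).tendsto
    rwa [hψ0] at this
  have hgc : ContDiffAt ℝ 2 (fun x => sigmaMin (imShift (A x) (ψ x))) a :=
    contDiffAt_comp_graph (hSc.of_le h23) hψc hψ0
  obtain ⟨η, hη, hgap⟩ := exists_sigmaMin_imShift_gap hlt hδ
  have hAη := Metric.tendsto_nhds.1 hAc η hη
  -- A perturbation of `A a` smaller than its positive distance to instability keeps the spectrum
  -- out of the closed right half-plane.
  have hAd := Metric.tendsto_nhds.1 hAc (distInstab (A a)) (by rwa [hatt])
  have hgη : ∀ᶠ x in 𝓝 a, sigmaMin (imShift (A x) (ψ x)) < sigmaMin (imShift (A a) b) + η :=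
    hgc.continuousAt.eventually_lt_const (by simpa only [hψ0] using lt_add_of_pos_right _ hη)
  have hgpos : ∀ᶠ x in 𝓝 a, 0 < sigmaMin (imShift (A x) (ψ x)) :=
    hgc.continuousAt.eventually_const_lt (by simpa only [hψ0] using hpos)
  have hkey : ∀ᶠ x in 𝓝 a, distInstab (A x) = sigmaMin (imShift (A x) (ψ x)) ∧
      ∀ w, sigmaMin (imShift (A x) w) ≤ sigmaMin (imShift (A x) (ψ x)) → w = ψ x := by
    filter_upwards [hψ, hAη, hAd, hgη, hgpos] with x hx hxη hxd hxg hxpos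
    rw [dist_eq_norm] at hxη hxd
    have hmin : ∀ w, sigmaMin (imShift (A x) (ψ x)) ≤ sigmaMin (imShift (A x) w) := fun w => by
      rcases lt_or_ge |w - b| δ with h | h
      · exact (hx w h).1
      · exact (hxg.trans (hgap _ hxη w h)).le
    refine ⟨le_antisymm (distInstab_le_sigmaMin _ _) (le_distInstab hxpos hmin fun z hz =>
      notMem_spectrum_of_norm_sub_lt hxd hz), fun w hw => ?_⟩
    rcases lt_or_ge |w - b| δ with h | h
    · exact (hx w h).2 hw
    · exact absurd hw (not_le.2 (hxg.trans (hgap _ hxη w h)))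
  refine ⟨e, ψ, fun x => U (x, ψ x), he, hψc, ?_, ?_, ?_⟩
  · exact contDiffAt_comp_graph (hUc.of_le h23) hψc hψ0
  · exact hgc.congr_of_eventuallyEq (hkey.mono fun x hx => hx.1)
  · filter_upwards [hkey, hgt.eventually hU] with x hx hxU
    refine ⟨hx.1, distInstab_le_sigmaMin _, ?_, hxU.1, ?_, ?_⟩
    · rw [hx.1]; exact hx.2
    · rw [hx.1]; exact hxU.2.1
    · rw [hx.1]; exact hxU.2.2

end Family

/-! ### One-variable estimates: interpolation error and quadratic decay -/

/-- The error of linear interpolation of a `C²` curve. -/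
lemma exists_interpolation_bound {F : Type*} [NormedAddCommGroup F] [NormedSpace ℝ F] {v : ℝ → F}
    {a : ℝ} (hv : ContDiffAt ℝ 2 v a) :
    ∃ C ≥ 0, ∃ δ > 0, ∀ x y z, |x - a| < δ → |y - a| < δ → |z - a| < δ → y ≠ z →
      ‖(v y + ((x - y) / (z - y)) • (v z - v y)) - v x‖ ≤ C * (|x - y| * |x - z|) := by
  have h1 : ContDiffAt ℝ 1 (deriv v) a :=
    ContDiffAt.clm_apply (hv.fderiv_right (m := 1) (by norm_num)) contDiffAt_const
  obtain ⟨K, t, ht, hK⟩ := h1.exists_lipschitzOnWith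
  have hd : ∀ᶠ x in 𝓝 a, DifferentiableAt ℝ v x := by
    filter_upwards [hv.eventually (by simp)] with x hx using hx.differentiableAt (by simp)
  obtain ⟨δ, hδ, hball⟩ := Metric.mem_nhds_iff.1 (inter_mem ht hd)
  refine ⟨K, K.2, δ, hδ, fun x y z hx hy hz hyz => ?_⟩
  have hseg : ∀ p q : ℝ, |p - a| < δ → |q - a| < δ → ∀ s ∈ Set.Icc (0 : ℝ) 1,
      p + s * (q - p) ∈ t ∩ {x | DifferentiableAt ℝ v x} := by
    intro p q hp hq s hs
    refine hball ?_
    have := (convex_ball a δ).add_smul_sub_mem (x := p) (y := q) hp hq hs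
    simpa using this
  have hder : ∀ q : ℝ, |q - a| < δ → ∀ s ∈ Set.Icc (0 : ℝ) 1,
      HasDerivAt (fun s : ℝ => v (y + s * (q - y))) ((q - y) • deriv v (y + s * (q - y))) s := by
    intro q hq s hs
    have hg : HasDerivAt (fun s : ℝ => y + s * (q - y)) (q - y) s := by
      simpa using ((hasDerivAt_id s).mul_const (q - y)).const_add y
    exact (hseg y q hy hq s hs).2.hasDerivAt.scomp s hg
  have hzy : z - y ≠ 0 := sub_ne_zero.2 hyz.symm
  -- The increment of this function over `[0, 1]` is the interpolation error. Its derivative is `x -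
  -- y` times a difference of values of `v'` at points `s (z - x)` apart, and `v'` is Lipschitz.
  -- Nothing requires `x` to lie between `y` and `z`.
  have key := norm_image_sub_le_of_norm_deriv_le_segment_01'
    (f := fun s : ℝ => ((x - y) / (z - y)) • v (y + s * (z - y)) - v (y + s * (x - y)))
    (f' := fun s : ℝ => ((x - y) / (z - y)) • ((z - y) • deriv v (y + s * (z - y)))
      - (x - y) • deriv v (y + s * (x - y))) (C := K * (|x - y| * |x - z|))
    (fun s hs => (((hder z hz s hs).const_smul _).sub (hder x hx s hs)).hasDerivWithinAt)
    (fun s hs => by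
      have hs' := Set.Ico_subset_Icc_self hs
      rw [smul_smul, div_mul_cancel₀ _ hzy, ← smul_sub, norm_smul, Real.norm_eq_abs]
      have h2 := hK.dist_le_mul _ (hseg y z hy hz s hs').1 _ (hseg y x hy hx s hs').1
      rw [dist_eq_norm, Real.dist_eq] at h2
      have h3 : y + s * (z - y) - (y + s * (x - y)) = s * (z - x) := by ring
      rw [h3, abs_mul, abs_of_nonneg hs.1, abs_sub_comm z x] at h2
      have h4 : s * |x - z| ≤ |x - z| := mul_le_of_le_one_left (abs_nonneg _) hs.2.le
      calc _ ≤ |x - y| * (K * (s * |x - z|)) := by gcongr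
        _ ≤ |x - y| * (K * |x - z|) := by gcongr
        _ = _ := by ring)
  refine le_trans (le_of_eq ?_) key
  congr 1
  simp only [one_mul, zero_mul, add_zero, add_sub_cancel, smul_sub]
  abel_nf

/-- A nondegenerate local maximum has quadratic decay. -/
lemma exists_quadratic_decay_of_isLocalMax {g : ℝ → ℝ} {a : ℝ} (hg : ContDiffAt ℝ 2 g a)
    (hmax : IsLocalMax g a) (h2 : iteratedDeriv 2 g a ≠ 0) :
    ∃ c > 0, ∀ᶠ x in 𝓝 a, g x ≤ g a - c * (x - a) ^ 2 := by
  rw [iteratedDeriv_succ, iteratedDeriv_one] at h2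
  have hd1 := hmax.deriv_eq_zero
  -- A positive second derivative would make `a` a local minimum too, so `g` would be locally
  -- constant.
  have hneg : deriv (deriv g) a < 0 := by
    refine lt_of_le_of_ne ?_ h2
    by_contra! hpos
    have hmin := isLocalMin_of_deriv_deriv_pos hpos hd1 hg.continuousAt
    have hconst : g =ᶠ[𝓝 a] fun _ => g a := by
      filter_upwards [hmax, hmin] with x h1 h2 using le_antisymm h1 h2
    have h3 : deriv g =ᶠ[𝓝 a] fun _ => 0 := by
      simpa using hconst.deriv
    rw [h3.deriv_eq] at hpos
    simp at hpos
  set m := deriv (deriv g) a with hm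
  -- Subtracting `m / 4 * (x - a) ^ 2` leaves second derivative `m / 2 < 0`, so `a` is still a local
  -- maximum.
  refine ⟨-m / 4, by linarith, ?_⟩
  set h : ℝ → ℝ := fun x => g x - m / 4 * (x - a) ^ 2 with hh
  have hq : ∀ x, HasDerivAt (fun x : ℝ => m / 4 * (x - a) ^ 2) (m / 2 * (x - a)) x := fun x => by
    have := (((hasDerivAt_id x).sub_const a).pow 2).const_mul (m / 4)
    refine this.congr_deriv ?_
    simp
    ring
  have hq2 : HasDerivAt (fun x : ℝ => m / 2 * (x - a)) (m / 2) a := by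
    simpa using ((hasDerivAt_id a).sub_const a).const_mul (m / 2)
  have hgd : ∀ᶠ x in 𝓝 a, deriv h x = deriv g x - m / 2 * (x - a) := by
    filter_upwards [hg.eventually (by simp)] with x hx
    exact ((hx.differentiableAt (by simp)).hasDerivAt.sub (hq x)).deriv
  have hgdd : DifferentiableAt ℝ (deriv g) a := differentiableAt_of_deriv_ne_zero hneg.ne
  have hh2 : deriv (deriv h) a = m / 2 := by
    have h3 : deriv h =ᶠ[𝓝 a] fun x => deriv g x - m / 2 * (x - a) := hgd
    rw [h3.deriv_eq, (hgdd.hasDerivAt.fun_sub hq2).deriv]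
    ring
  have hh1 : deriv h a = 0 := by
    rw [hgd.self_of_nhds, hd1]; simp
  have hhm := isLocalMax_of_deriv_deriv_neg (f := h) (x₀ := a) (by rw [hh2]; linarith) hh1
    (hg.continuousAt.sub (by fun_prop))
  filter_upwards [hhm] with x hx
  simp only [hh, sub_self] at hx
  linarith

/-! ### Two-sided bounds for the reduced distance -/

section Reduced

variable {H : Type*} [NormedAddCommGroup H] [InnerProductSpace ℂ H]

lemma redDist_nonneg (V : Submodule ℂ H) (T : H →L[ℂ] H) : 0 ≤ redDist V T :=
  Real.iInf_nonneg fun _ => sigmaMin_nonneg _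

lemma redDist_mul_norm_le (V : Submodule ℂ H) (T : H →L[ℂ] H) (w : ℝ) {u : H} (hu : u ∈ V) :
    redDist V T * ‖u‖ ≤ ‖imShift T w u‖ := by
  have h1 : redDist V T ≤ sigmaMin ((imShift T w).comp V.subtypeL) :=
    ciInf_le ⟨0, by rintro r ⟨w, rfl⟩; exact sigmaMin_nonneg _⟩ w
  have h2 := sigmaMin_mul_norm_le ((imShift T w).comp V.subtypeL) ⟨u, hu⟩
  exact (mul_le_mul_of_nonneg_right h1 (norm_nonneg _)).trans h2

/-- Restriction to a subspace can only raise the smallest singular value. A nonzero vector is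
required because on the zero subspace the infimum is over the empty set and equals `0`. -/
lemma distInstab_le_redDist {V : Submodule ℂ H} {v : H} (hv : v ∈ V) (hv0 : v ≠ 0)
    (T : H →L[ℂ] H) : distInstab T ≤ redDist V T := by
  have : Nontrivial H := ⟨v, 0, hv0⟩
  have : Nontrivial V := ⟨⟨v, hv⟩, 0, by simpa using hv0⟩
  refine le_ciInf fun w => (distInstab_le_sigmaMin T w).trans ?_
  exact le_sigmaMin fun u => sigmaMin_mul_norm_le (imShift T w) u

variable [CompleteSpace H]

/-- The form `‖S u‖² - s ‖u‖²` has `v` in its kernel, so its value at `u` equals that at `u - v`: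
the error is of second order. -/
lemma norm_apply_sq_le_of_eigenvector {S : H →L[ℂ] H} {s : ℝ} (hs : 0 ≤ s) {v : H}
    (hv : adjoint S (S v) = (s : ℂ) • v) (u : H) :
    ‖S u‖ ^ 2 ≤ s * ‖u‖ ^ 2 + ‖S‖ ^ 2 * ‖u - v‖ ^ 2 := by
  have hinner : ∀ w, ⟪S w, S v⟫_ℂ = (s : ℂ) * ⟪w, v⟫_ℂ := fun w => by
    rw [← adjoint_inner_right, hv, inner_smul_right]
  have h1 : ∀ w, (⟪S w, S v⟫_ℂ).re = s * (⟪w, v⟫_ℂ).re := fun w => by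
    rw [hinner, Complex.re_ofReal_mul]
  have e1 : ‖S (u - v)‖ ^ 2 = ‖S u‖ ^ 2 - 2 * (⟪S u, S v⟫_ℂ).re + ‖S v‖ ^ 2 := by
    rw [map_sub]; exact norm_sub_sq (𝕜 := ℂ) _ _
  have e2 : ‖u - v‖ ^ 2 = ‖u‖ ^ 2 - 2 * (⟪u, v⟫_ℂ).re + ‖v‖ ^ 2 := norm_sub_sq (𝕜 := ℂ) _ _
  have e3 : ‖S v‖ ^ 2 = s * ‖v‖ ^ 2 := by
    have h2 : (⟪S v, S v⟫_ℂ).re = ‖S v‖ ^ 2 := inner_self_eq_norm_sq (𝕜 := ℂ) _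
    have h3 : (⟪v, v⟫_ℂ).re = ‖v‖ ^ 2 := inner_self_eq_norm_sq (𝕜 := ℂ) _
    rw [← h2, h1, h3]
  have h4 : ‖S (u - v)‖ ^ 2 ≤ ‖S‖ ^ 2 * ‖u - v‖ ^ 2 := by
    rw [← mul_pow]
    exact pow_le_pow_left₀ (norm_nonneg _) (S.le_opNorm _) 2
  rw [h1] at e1
  have h5 : 0 ≤ s * ‖u - v‖ ^ 2 := by positivity
  have h6 : s * ‖u - v‖ ^ 2 = s * ‖u‖ ^ 2 - 2 * (s * (⟪u, v⟫_ℂ).re) + s * ‖v‖ ^ 2 := by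
    rw [e2]; ring
  linarith

/-- The reduced distance exceeds a positive singular value by at most the squared distance of the
singular vector from the subspace. -/
lemma redDist_le_add {V : Submodule ℂ H} {T : H →L[ℂ] H} {w g m B : ℝ} {u v : H} (hm : 0 < m)
    (hg : m ≤ g) (hB : ‖imShift T w‖ ≤ B)
    (hv : adjoint (imShift T w) (imShift T w v) = ((g ^ 2 : ℝ) : ℂ) • v) (hu : u ∈ V)
    (hu1 : 1 ≤ ‖u‖) : redDist V T ≤ g + B ^ 2 / m * ‖u - v‖ ^ 2 := by
  have hr0 := redDist_nonneg V T
  set r := redDist V T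
  have h1 := redDist_mul_norm_le V T w hu
  have h2 := norm_apply_sq_le_of_eigenvector (sq_nonneg g) hv u
  have h3 : r ^ 2 * ‖u‖ ^ 2 ≤ ‖imShift T w u‖ ^ 2 := by
    rw [← mul_pow]
    exact pow_le_pow_left₀ (by positivity) h1 2
  have h4 : ‖imShift T w‖ ^ 2 * ‖u - v‖ ^ 2 ≤ B ^ 2 * ‖u - v‖ ^ 2 := by gcongr
  set X := B ^ 2 * ‖u - v‖ ^ 2 with hX
  have hX0 : 0 ≤ X := by positivity
  have hu2 : 1 ≤ ‖u‖ ^ 2 := one_le_pow₀ hu1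
  have h5 : r ^ 2 - g ^ 2 ≤ X := by
    by_contra! hlt
    nlinarith
  have h6 : B ^ 2 / m * ‖u - v‖ ^ 2 = X / m := by rw [hX]; ring
  rw [h6, ← sub_le_iff_le_add', le_div_iff₀ hm]
  -- When `r > g`, one has `m (r - g) ≤ (r + g)(r - g) = r² - g² ≤ X`.
  rcases le_or_gt r g with h | h
  · nlinarith
  · nlinarith

end Reduced

/-- The error recursion behind the rate of convergence. -/
lemma le_mul_of_le_mul_add_mul_add {B E d d' : ℝ} (hE : 0 ≤ E)
    (h : E ≤ B * ((E + d) * (E + d'))) (hsmall : B * (E + d + d') ≤ 1 / 2) :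
    E ≤ 2 * B * (d * d') := by
  have h1 : B * ((E + d) * (E + d')) = B * (E + d + d') * E + B * (d * d') := by ring
  have h2 := mul_le_mul_of_nonneg_right hsmall hE
  linarith

/-! ### Rate of convergence -/

section Rate

variable {H : Type*} [NormedAddCommGroup H] [InnerProductSpace ℂ H] [CompleteSpace H]

lemma IsSubspaceRun.mem_span {A : ℝ → H →L[ℂ] H} {K : Set ℝ} {x ω : ℕ → ℝ} {v : ℕ → H}
    {𝒱 : ℕ → Submodule ℂ H} (hrun : IsSubspaceRun A K x ω v 𝒱) {l : ℕ} (hl : 1 ≤ l) :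
    v l ∈ 𝒱 l := by
  obtain rfl | hl' := eq_or_lt_of_le hl
  · rw [hrun.span_one]; exact Submodule.mem_span_singleton_self _
  · obtain ⟨m, rfl⟩ : ∃ m, l = m + 1 := ⟨l - 1, by omega⟩
    rw [hrun.span_succ m (by omega)]
    exact Submodule.mem_sup_right (Submodule.mem_span_singleton_self _)

lemma IsSubspaceRun.le_succ {A : ℝ → H →L[ℂ] H} {K : Set ℝ} {x ω : ℕ → ℝ} {v : ℕ → H}
    {𝒱 : ℕ → Submodule ℂ H} (hrun : IsSubspaceRun A K x ω v 𝒱) {l : ℕ} (hl : 1 ≤ l) :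
    𝒱 l ≤ 𝒱 (l + 1) := by
  rw [hrun.span_succ l hl]; exact le_sup_left

/-- The rate of convergence of the subspace framework, for operator functions that are three times
continuously differentiable near the limit. -/
theorem IsSubspaceRun.exists_rate {A : ℝ → H →L[ℂ] H} {K : Set ℝ} {x ω : ℕ → ℝ} {v : ℕ → H}
    {𝒱 : ℕ → Submodule ℂ H} (hrun : IsSubspaceRun A K x ω v 𝒱) {a b : ℝ}
    (hA : ContDiffAt ℝ 3 A a) (hconv : Tendsto x atTop (𝓝 a)) (haK : a ∈ interior K)
    (hatt : distInstab (A a) = sigmaMin (imShift (A a) b))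
    (huniq : ∀ w, distInstab (A a) = sigmaMin (imShift (A a) w) → w = b)
    (hpos : 0 < sigmaMin (imShift (A a) b))
    (hsimple : IsSimpleSingularValue (imShift (A a) b) (sigmaMin (imShift (A a) b)))
    (h2 : 0 < iteratedDeriv 2 (fun w => sigmaMin (imShift (A a) w)) b)
    (hD2 : iteratedDeriv 2 (fun y => distInstab (A y)) a ≠ 0) :
    ∃ B : ℝ, ∀ᶠ l in atTop, x (l + 1) ≠ a →
      |x (l + 2) - a| ≤ B * (|x (l + 1) - a| * |x l - a|) := by
  have : Nontrivial H := ⟨v 1, 0, (hrun.singular 1 le_rfl).1⟩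
  obtain ⟨e, ψ, u, he, hψc, huc, hgc, hloc⟩ :=
    exists_local_structure hA hatt huniq hpos hsimple h2
  set g : ℝ → ℝ := fun y => distInstab (A y) with hg
  -- singular vectors of the run
  have huV : ∀ l, 1 ≤ l → (distInstab (A (x l)) = sigmaMin (imShift (A (x l)) (ψ (x l))) ∧
      (∀ w, sigmaMin (imShift (A (x l)) w) ≤ distInstab (A (x l)) → w = ψ (x l)) ∧
      ∀ w, adjoint (imShift (A (x l)) (ψ (x l))) (imShift (A (x l)) (ψ (x l)) w) =
          ((distInstab (A (x l)) ^ 2 : ℝ) : ℂ) • w → w = ⟪e, w⟫_ℂ • u (x l)) → u (x l) ∈ 𝒱 l := by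
    intro l hl ⟨h1, h2, h3⟩
    -- Uniqueness of the minimizer fixes the frequency chosen by the run, and simplicity then makes
    -- `v l` a multiple of `u (x l)`.
    have hω : ω l = ψ (x l) := h2 _ (by rw [h1]; exact hrun.isMinOn_omega l hl (Set.mem_univ _))
    obtain ⟨hv0, hv⟩ := hrun.singular l hl
    rw [hω, ← h1] at hv
    have h4 := h3 (v l) (by simpa using hv)
    have hc : ⟪e, v l⟫_ℂ ≠ 0 := fun h => hv0 (by rw [h4, h, zero_smul])
    have h5 : u (x l) = (⟪e, v l⟫_ℂ)⁻¹ • v l := by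
      rw [eq_inv_smul_iff₀ hc]
      exact h4.symm
    rw [h5]
    exact Submodule.smul_mem _ _ (hrun.mem_span hl)
  -- uniform bounds near the limit
  have hgpos : 0 < g a := by rw [hg]; simpa only [hatt] using hpos
  obtain ⟨m, hm, hmg⟩ := exists_between hgpos
  have hm_ev : ∀ᶠ y in 𝓝 a, m ≤ g y :=
    (hgc.continuousAt.eventually_const_lt hmg).mono fun _ h => h.le
  have hTc : ContinuousAt (fun y => ‖imShift (A y) (ψ y)‖) a :=
    (contDiffAt_comp_graph (n := 2) ((contDiffAt_imShift hA (ψ a)).of_le (by norm_num)) hψc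
      rfl).continuousAt.norm
  set B := ‖imShift (A a) (ψ a)‖ + 1 with hB
  have hB_ev : ∀ᶠ y in 𝓝 a, ‖imShift (A y) (ψ y)‖ ≤ B :=
    (hTc.eventually_lt_const (lt_add_one _)).mono fun _ h => h.le
  have hupper : ∀ᶠ y in 𝓝 a, ∀ (V : Submodule ℂ H) (w : H), w ∈ V → ⟪e, w⟫_ℂ = 1 →
      redDist V (A y) ≤ g y + B ^ 2 / m * ‖w - u y‖ ^ 2 := by
    filter_upwards [hloc, hm_ev, hB_ev] with y hy hym hyB V w hw hew
    refine redDist_le_add hm hym hyB hy.2.2.2.2.1 hw ?_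
    have := norm_inner_le_norm (𝕜 := ℂ) e w
    simpa [hew, he] using this
  set C := B ^ 2 / m with hC
  have hC0 : 0 ≤ C := by positivity
  have hlower : ∀ l, 1 ≤ l → ∀ y ∈ K, g y ≤ redDist (𝒱 l) (A (x (l + 1))) := fun l hl y hy =>
    (distInstab_le_redDist (hrun.mem_span hl) (hrun.singular l hl).1 (A y)).trans
      (hrun.isMaxOn_next l hl hy)
  have hconv1 : Tendsto (fun l => x (l + 1)) atTop (𝓝 a) := hconv.comp (tendsto_add_atTop_nat 1)
  have hconv2 : Tendsto (fun l => x (l + 2)) atTop (𝓝 a) := hconv.comp (tendsto_add_atTop_nat 2)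
  have huV_ev : ∀ᶠ l in atTop, u (x l) ∈ 𝒱 l ∧ ⟪e, u (x l)⟫_ℂ = 1 := by
    filter_upwards [hconv.eventually hloc, eventually_ge_atTop 1] with l hl hl1
    exact ⟨huV l hl1 ⟨hl.1, hl.2.2.1, hl.2.2.2.2.2⟩, hl.2.2.2.1⟩
  have huV1_ev : ∀ᶠ l in atTop, u (x (l + 1)) ∈ 𝒱 (l + 1) ∧ ⟪e, u (x (l + 1))⟫_ℂ = 1 :=
    (tendsto_add_atTop_nat 1).eventually huV_ev
  have hsingle : ∀ᶠ l in atTop, redDist (𝒱 l) (A (x (l + 1))) ≤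
      g (x (l + 1)) + C * ‖u (x l) - u (x (l + 1))‖ ^ 2 := by
    filter_upwards [hconv1.eventually hupper, huV_ev] with l h1 h2
    exact h1 _ _ h2.1 h2.2
  -- the limit maximizes the distance
  have hmaxK : ∀ y ∈ K, g y ≤ g a := by
    intro y hy
    have hlim : Tendsto (fun l => g (x (l + 1)) + C * ‖u (x l) - u (x (l + 1))‖ ^ 2) atTop
        (𝓝 (g a)) := by
      have h1 := hgc.continuousAt.tendsto.comp hconv1
      have h2 := huc.continuousAt.tendsto.comp hconv
      have h3 := huc.continuousAt.tendsto.comp hconv1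
      have h4 := h1.add ((((h2.sub h3).norm).pow 2).const_mul C)
      simpa using h4
    refine ge_of_tendsto hlim ?_
    filter_upwards [hsingle, eventually_ge_atTop 1] with l h1 hl
    exact (hlower l hl y hy).trans h1
  have hmax : IsLocalMax g a := by
    filter_upwards [mem_interior_iff_mem_nhds.1 haK] with y hy using hmaxK y hy
  obtain ⟨c, hc, hdecay⟩ := exists_quadratic_decay_of_isLocalMax hgc hmax hD2
  obtain ⟨L, hL, δ, hδ, hinterp⟩ := exists_interpolation_bound huc
  have hnear : ∀ᶠ y in 𝓝 a, |y - a| < δ := Metric.tendsto_nhds.1 tendsto_id δ hδ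
  -- Chosen so that `c d² ≤ C (L p)²` gives `d ≤ Q p` for nonnegative `d` and `p`.
  set Q := Real.sqrt (C * L ^ 2 / c) with hQ
  have hsmall : ∀ᶠ l in atTop, Q * (|x (l + 2) - a| + |x (l + 1) - a| + |x l - a|) ≤ 1 / 2 := by
    have habs : ∀ {y : ℕ → ℝ}, Tendsto y atTop (𝓝 a) → Tendsto (fun l => |y l - a|) atTop (𝓝 0) :=
      fun h => by simpa using (h.sub_const a).abs
    have h1 := (((habs hconv2).add (habs hconv1)).add (habs hconv)).const_mul Q
    simp only [add_zero, mul_zero] at h1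
    exact (h1.eventually_lt_const (by norm_num : (0 : ℝ) < 1 / 2)).mono fun _ h => h.le
  refine ⟨2 * Q, ?_⟩
  filter_upwards [hconv2.eventually hupper, hconv2.eventually hdecay, hconv1.eventually hdecay,
    hconv.eventually hnear, hconv1.eventually hnear, hconv2.eventually hnear, huV_ev, huV1_ev,
    hsingle, hsmall, eventually_ge_atTop 1] with l hup hdec2 hdec1 hn0 hn1 hn2 hu0 hu1 hsin hsm hl hne
  have haK' := interior_subset haK
  -- Interpolation needs distinct nodes. If they coincided, the reduced distance would be exact at
  -- `x (l+1)`, giving `g a ≤ g (x (l+1))`, and quadratic decay would force `x (l+1) = a`.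
  have hxne : x l ≠ x (l + 1) := by
    intro heq
    rw [heq, sub_self, norm_zero] at hsin
    have h3 := hlower l hl a haK'
    have h4 : c * (x (l + 1) - a) ^ 2 ≤ 0 := by
      have : C * (0 : ℝ) ^ 2 = 0 := by ring
      linarith
    have h5 : 0 < (x (l + 1) - a) ^ 2 := by
      have := sub_ne_zero.2 hne
      positivity
    nlinarith
  set t : ℝ := (x (l + 2) - x l) / (x (l + 1) - x l) with ht
  -- An affine combination preserves `⟪e, w⟫ = 1`, hence `‖w‖ ≥ 1`, with no renormalization.
  set w : H := u (x l) + t • (u (x (l + 1)) - u (x l)) with hw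
  have hwV : w ∈ 𝒱 (l + 1) := by
    have h3 := hrun.le_succ hl hu0.1
    have h4 : t • (u (x (l + 1)) - u (x l)) = (t : ℂ) • (u (x (l + 1)) - u (x l)) :=
      (Complex.coe_smul t _).symm
    rw [hw, h4]
    exact add_mem h3 (Submodule.smul_mem _ _ (sub_mem hu1.1 h3))
  have hew : ⟪e, w⟫_ℂ = 1 := by
    rw [hw, ← Complex.coe_smul, inner_add_right, inner_smul_right, inner_sub_right, hu0.2, hu1.2]
    simp
  have h3 := hup _ w hwV hew
  have h4 := hlower (l + 1) (by omega) a haK'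
  have h5 := hinterp (x (l + 2)) (x l) (x (l + 1)) hn2 hn0 hn1 hxne
  have h6 : c * (x (l + 2) - a) ^ 2
      ≤ C * (L * (|x (l + 2) - x l| * |x (l + 2) - x (l + 1)|)) ^ 2 := by
    have h7 : C * ‖w - u (x (l + 2))‖ ^ 2
        ≤ C * (L * (|x (l + 2) - x l| * |x (l + 2) - x (l + 1)|)) ^ 2 := by
      gcongr
    have h8 : g a ≤ g (x (l + 2)) + C * ‖w - u (x (l + 2))‖ ^ 2 := h4.trans h3
    linarith
  have htri : ∀ y z : ℝ, |y - z| ≤ |y - a| + |z - a| := fun y z => by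
    rw [abs_sub_comm z a]; exact abs_sub_le y a z
  have h9 : |x (l + 2) - a| ≤ Q * (|x (l + 2) - x l| * |x (l + 2) - x (l + 1)|) := by
    refine abs_le_of_sq_le_sq ?_ (by positivity)
    rw [mul_pow, hQ, Real.sq_sqrt (by positivity), div_mul_eq_mul_div, le_div_iff₀ hc]
    linarith [mul_pow L (|x (l + 2) - x l| * |x (l + 2) - x (l + 1)|) 2]
  have h10 : |x (l + 2) - a| ≤ Q * ((|x (l + 2) - a| + |x (l + 1) - a|) *
      (|x (l + 2) - a| + |x l - a|)) := by
    refine h9.trans ?_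
    rw [mul_comm |x (l + 2) - x l|]
    gcongr
    · exact htri _ _
    · exact htri _ _
  exact le_mul_of_le_mul_add_mul_add (abs_nonneg _) h10 hsm

end Rate

end DistInstab

theorem theorem6p2
    {H : Type*} [NormedAddCommGroup H] [InnerProductSpace ℂ H] [CompleteSpace H]
    {κ : ℕ} (Ω K : Set ℝ) (hΩ : IsOpen Ω) (hK : IsCompact K) (hKΩ : K ⊆ Ω)
    (f : Fin κ → ℝ → ℝ) (hf : ∀ j, AnalyticOnNhd ℝ (f j) Ω)
    (A : Fin κ → H →L[ℂ] H)
    -- uniform stability: eigenvalues in the closed left half-plane on the feasible region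
    (hstab : ∀ y ∈ K, ∀ z : ℂ,
      Module.End.HasEigenvalue (DistInstab.opFamily f A y : H →ₗ[ℂ] H) z → z.re ≤ 0)
    -- iterates converging to an interior point
    (x ω : ℕ → ℝ) (v : ℕ → H) (𝒱 : ℕ → Submodule ℂ H)
    (hrun : DistInstab.IsSubspaceRun (DistInstab.opFamily f A) K x ω v 𝒱)
    (xs : ℝ) (hconv : Filter.Tendsto x Filter.atTop (nhds xs)) (hxs : xs ∈ interior K)
    -- the distance at the limit is attained at `ωs` and only there
    (ωs : ℝ)
    (hatt : DistInstab.distInstab (DistInstab.opFamily f A xs) =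
      DistInstab.sigmaMin (DistInstab.imShift (DistInstab.opFamily f A xs) ωs))
    (huniq : ∀ w : ℝ, DistInstab.distInstab (DistInstab.opFamily f A xs) =
      DistInstab.sigmaMin (DistInstab.imShift (DistInstab.opFamily f A xs) w) → w = ωs)
    -- the smallest singular value there is positive and simple
    (hpos : 0 < DistInstab.sigmaMin (DistInstab.imShift (DistInstab.opFamily f A xs) ωs))
    (hsimple : DistInstab.IsSimpleSingularValue
      (DistInstab.imShift (DistInstab.opFamily f A xs) ωs)
      (DistInstab.sigmaMin (DistInstab.imShift (DistInstab.opFamily f A xs) ωs)))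
    -- second derivatives
    (hω2 : 0 < iteratedDeriv 2
      (fun w : ℝ => DistInstab.sigmaMin (DistInstab.imShift (DistInstab.opFamily f A xs) w)) ωs)
    (hD2 : iteratedDeriv 2
      (fun y : ℝ => DistInstab.distInstab (DistInstab.opFamily f A y)) xs ≠ 0) :
    ∃ μ : ℝ, 0 < μ ∧ ∀ l : ℕ, 2 ≤ l → x l ≠ xs →
      |x (l + 1) - xs| / (|x l - xs| * max |x l - xs| |x (l - 1) - xs|) ≤ μ := by
  have hA : ContDiffAt ℝ 3 (DistInstab.opFamily f A) xs :=
    DistInstab.contDiffAt_opFamily (fun j => (hf j xs (hKΩ (interior_subset hxs))).contDiffAt) A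
  obtain ⟨B, hB⟩ := hrun.exists_rate hA hconv hxs hatt huniq hpos hsimple hω2 hD2
  obtain ⟨N, hN⟩ := Filter.eventually_atTop.1 hB
  set r : ℕ → ℝ := fun l => |x (l + 1) - xs| / (|x l - xs| * max |x l - xs| |x (l - 1) - xs|)
    with hr
  have hr0 : ∀ l, 0 ≤ r l := fun l => by positivity
  have hsum : 0 ≤ ∑ l ∈ Finset.range (N + 1), r l := Finset.sum_nonneg fun l _ => hr0 l
  -- `|B|` bounds the ratios from index `N + 1` on, the sum bounds the finitely many earlier ones,
  -- and `1` ensures positivity.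
  refine ⟨|B| + ∑ l ∈ Finset.range (N + 1), r l + 1, by positivity, fun l _ hne => ?_⟩
  change r l ≤ _
  rcases lt_or_ge l (N + 1) with h | h
  · have := Finset.single_le_sum (fun l _ => hr0 l) (Finset.mem_range.2 h)
    linarith [abs_nonneg B]
  · obtain ⟨m, rfl⟩ : ∃ m, l = m + 1 := ⟨l - 1, by omega⟩
    have h1 : 0 < |x (m + 1) - xs| := abs_pos.2 (sub_ne_zero.2 hne)
    have h2 : r (m + 1) ≤ |B| := by
      simp only [hr, Nat.add_sub_cancel]
      have h3 : 0 < max |x (m + 1) - xs| |x m - xs| := lt_max_of_lt_left h1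
      rw [div_le_iff₀ (by positivity)]
      calc |x (m + 2) - xs| ≤ B * (|x (m + 1) - xs| * |x m - xs|) := hN m (by omega) hne
        _ ≤ |B| * (|x (m + 1) - xs| * max |x (m + 1) - xs| |x m - xs|) := by
          gcongr
          · exact le_abs_self B
          · exact le_max_right _ _
    linarith
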